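/- Let $m\ge 2$ be an integer. Let $c_1:\mathbb{R}\to\mathbb{R}$ be a smooth function whose critical set $S(c_1)=\{x : c_1'(x)=0\}$ is non-empty and is the disjoint union of at most countably many sets, each of which is a point, a compact interval, a closed half-line or $\mathbb{R}$. Let $N>0$ be such that the values of $c_1$ on any two consecutive connected components of $S(c_1)$ differ by more than $N$ in absolute value. Let $0<a<N$, $c_2=c_1+a$, $D=\{(x_1,x_2)\in\mathbb{R}^2 : c_1(x_2)<x_1<c_2(x_2)\}$, and $$X=\Big\{(x_1,x_2,y)\in\overline{D}\times\mathbb{R}^{m-1} : (x_1-c_1(x_2))(c_2(x_2)-x_1)-\sum_{j=1}^{m-1}y_j^2=0\Big\}\subset\mathbb{R}^{m+1}.$$ If $m=2$, suppose also that no line $\{p\}\times\mathbb{R}$ is contained in $D$ (this holds whenever $S(c_1)$ is not connected). Let $h:X\to\mathbb{R}$, $h(x_1,x_2,y)=x_1$, let $R$ be its Reeb space, that is, the quotient of $X$ whose points are the connected components of the level sets of $h$, and let $\bar h:R\to\mathbb{R}$ be the function induced by $h$. Then $R$ is a graph with ends whose vertices are the points given by the components of level sets of $h$ that contain a critical point of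 $h$, and every vertex has degree $1$, $2$ or $3$. Moreover $\bar h$ makes $R$ a digraph, where an edge departs from (resp. enters) an incident vertex if $\bar h$, restricted to the closure of the edge, has its minimum (resp. maximum) there; and every vertex at which $\bar h$ has a local extremum has degree $1$. Here a graph with ends is a connected, locally compact, Hausdorff space decomposed into vertices and open edges, with the weak topology and locally finite, in which the closure of each edge is either an arc joining two distinct vertices or a closed half-line starting at a vertex; the degree of a vertex is the number of edges whose closure contains it. -/

import Mathlib

open Set Topology
open scoped ContDiff

namespace ReebTS

/-! ## Reeb spaces -/

section Reeb

/-- The contour of `c` through `x`: the connected component of the level set of `c`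
through `x` that contains `x`. -/
def contour {X : Type*} [TopologicalSpace X] (c : X → ℝ) (x : X) : Set X :=
  connectedComponentIn (c ⁻¹' {c x}) x

/-- Two points are equivalent if and only if they lie in the same contour of `c`. -/
def reebSetoid {X : Type*} [TopologicalSpace X] (c : X → ℝ) : Setoid X :=
  Setoid.ker (contour c)

theorem eq_of_reebSetoid {X : Type*} [TopologicalSpace X] (c : X → ℝ) (x y : X)
    (h : reebSetoid c x y) : c x = c y := by
  have hxy : contour c x = contour c y := h
  have hx : x ∈ contour c x := mem_connectedComponentIn (by simp)
  rw [hxy] at hx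
  have hx' : x ∈ c ⁻¹' {c y} := connectedComponentIn_subset _ _ hx
  simpa using hx'

/-- The Reeb space of `c`, the quotient of the domain whose points are the contours of `c`. -/
def ReebSpace {X : Type*} [TopologicalSpace X] (c : X → ℝ) : Type _ :=
  Quotient (reebSetoid c)

instance {X : Type*} [TopologicalSpace X] (c : X → ℝ) : TopologicalSpace (ReebSpace c) :=
  inferInstanceAs (TopologicalSpace (Quotient (reebSetoid c)))

/-- The quotient map to the Reeb space. -/
def reebMk {X : Type*} [TopologicalSpace X] (c : X → ℝ) (x : X) : ReebSpace c :=
  Quotient.mk (reebSetoid c) x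

/-- The function induced by `c` on its Reeb space. -/
def reebInduced {X : Type*} [TopologicalSpace X] (c : X → ℝ) : ReebSpace c → ℝ :=
  Quotient.lift c (eq_of_reebSetoid c)

end Reeb

/-! ## Graphs with ends -/

section Graph

/-- The edges determined by a vertex set `V`: the connected components of its complement. -/
def edges {R : Type*} [TopologicalSpace R] (V : Set R) : Set (Set R) :=
  {e | ∃ x ∈ Vᶜ, e = connectedComponentIn Vᶜ x}

/-- The closure of the edge `e` is an arc, both of whose end points, and no other points,
are vertices. -/
def IsArcEdge {R : Type*} [TopologicalSpace R] (V e : Set R) : Prop :=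
  ∃ γ : Icc (0 : ℝ) 1 ≃ₜ closure e, ∀ t, (γ t : R) ∈ V ↔ (t : ℝ) = 0 ∨ (t : ℝ) = 1

/-- The closure of the edge `e` is a closed half-line, whose end point, and no other point,
is a vertex. -/
def IsEndEdge {R : Type*} [TopologicalSpace R] (V e : Set R) : Prop :=
  ∃ γ : Ici (0 : ℝ) ≃ₜ closure e, ∀ t, (γ t : R) ∈ V ↔ (t : ℝ) = 0

/-- `R` is a graph with ends with vertex set `V`: it is a connected, locally compact, Hausdorff
space, the disjoint union of the vertices and of open edges, with the weak topology
determined by the closed cells, which form a locally finite family; the closure of each edge is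
either an arc joining two vertices or a half-line starting at a vertex. -/
structure IsGraphWithEnds (R : Type*) [TopologicalSpace R] (V : Set R) : Prop where
  t2 : T2Space R
  connected : ConnectedSpace R
  locallyCompact : LocallyCompactSpace R
  edge : ∀ e ∈ edges V, IsArcEdge V e ∨ IsEndEdge V e
  weakTopology : ∀ A : Set R, (∀ e ∈ edges V, IsClosed (A ∩ closure e)) → IsClosed A
  locallyFinite : LocallyFinite (fun e : edges V => closure (e : Set R))

/-- The degree of `v`: the number of edges incident to `v`, as an extended natural number. -/
noncomputable def degree {R : Type*} [TopologicalSpace R] (V : Set R) (v : R) : ℕ∞ :=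
  {e | e ∈ edges V ∧ v ∈ closure e}.encard

/-- The edge `e` departs from the vertex `v`: on the closure of `e`, the function `g` has
its minimum at `v`. -/
def Departs {R : Type*} [TopologicalSpace R] (g : R → ℝ) (e : Set R) (v : R) : Prop :=
  v ∈ closure e ∧ IsMinOn g (closure e) v

/-- The edge `e` enters the vertex `v`: on the closure of `e`, the function `g` has
its maximum at `v`. -/
def Enters {R : Type*} [TopologicalSpace R] (g : R → ℝ) (e : Set R) (v : R) : Prop :=
  v ∈ closure e ∧ IsMaxOn g (closure e) v

/-- `g` makes the graph with ends `R` a digraph: every edge either departs from or enters (and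
not both) each vertex incident to it, it departs from at most one vertex, and it enters at most
one vertex. -/
structure IsDigraphBy {R : Type*} [TopologicalSpace R] (V : Set R) (g : R → ℝ) : Prop where
  orientation : ∀ e ∈ edges V, ∀ v ∈ V, v ∈ closure e → Xor (Departs g e v) (Enters g e v)
  departs_unique : ∀ e ∈ edges V, {v | v ∈ V ∧ Departs g e v}.Subsingleton
  enters_unique : ∀ e ∈ edges V, {v | v ∈ V ∧ Enters g e v}.Subsingleton

end Graph

/-! ## Critical points -/

section Critical

/-- The tangent vectors at `p` of a submanifold `M` of a normed space: the velocities
at `p` of the smooth curves in `M` through `p`. -/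
def tangentVectors {E : Type*} [NormedAddCommGroup E] [NormedSpace ℝ E]
    (M : Set E) (p : E) : Set E :=
  {v | ∃ γ : ℝ → E, ContDiffAt ℝ ∞ γ 0 ∧ γ 0 = p ∧ (∀ᶠ t in 𝓝 (0 : ℝ), γ t ∈ M) ∧
    HasDerivAt γ v 0}

/-- `p` is a critical point of the restriction to the submanifold `M` of a smooth function `g`:
the differential of `g` vanishes on the tangent space of `M` at `p`. -/
def IsCriticalPointOn {E : Type*} [NormedAddCommGroup E] [NormedSpace ℝ E]
    (M : Set E) (g : E → ℝ) (p : E) : Prop :=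
  p ∈ M ∧ ∀ v ∈ tangentVectors M p, fderiv ℝ g p v = 0

/-- The critical set of a differentiable function of one real variable. -/
def criticalSet (c : ℝ → ℝ) : Set ℝ := {x | deriv c x = 0}

/-- A real-valued function on the real line with tame singularities: a smooth function
whose critical set is the disjoint union of at most countably many sets, each of which is a
one-point set, a compact interval, a closed half-line or the line. -/
def IsTS (c : ℝ → ℝ) : Prop :=
  ContDiff ℝ ∞ c ∧
    ∃ S : Set (Set ℝ), S.Countable ∧ S.PairwiseDisjoint id ∧ ⋃₀ S = criticalSet c ∧
      ∀ I ∈ S, (∃ x, I = {x}) ∨ (∃ x y, x < y ∧ I = Icc x y) ∨ (∃ x, I = Ici x) ∨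
        (∃ x, I = Iic x) ∨ I = univ

/-- The values of `c` on consecutive components of its critical set always differ by more
than `N`. Here `x` is the right end of a component and `y` is the left end of the next one. -/
def ConsecutiveValuesDifferBy (c : ℝ → ℝ) (N : ℝ) : Prop :=
  ∀ x y : ℝ, x < y → x ∈ criticalSet c → y ∈ criticalSet c →
    (∀ t ∈ Ioo x y, t ∉ criticalSet c) → N < |c x - c y|

end Critical

/-! ## The region between two graphs and the hypersurface over it -/

section Region

/-- The open region between the graphs `x₁ = c₁ x₂` and `x₁ = c₂ x₂`. -/
def region (c₁ c₂ : ℝ → ℝ) : Set (ℝ × ℝ) :=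
  {x | c₁ x.2 < x.1 ∧ x.1 < c₂ x.2}

/-- `ℝ ^ (m + 1)`, with coordinates `((x₁, x₂), (y₁, …, y₍ₘ₋₁₎))`. -/
abbrev Ambient (m : ℕ) : Type := (ℝ × ℝ) × EuclideanSpace ℝ (Fin (m - 1))

/-- The hypersurface of `ℝ ^ (m + 1)` over the closure of the region. -/
def hypersurface (m : ℕ) (c₁ c₂ : ℝ → ℝ) : Set (Ambient m) :=
  {z | z.1 ∈ closure (region c₁ c₂) ∧
    (z.1.1 - c₁ z.1.2) * (c₂ z.1.2 - z.1.1) - ∑ j, z.2 j ^ 2 = 0}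

/-- The projection of `ℝ ^ (m + 1)` to the first coordinate. -/
def proj (m : ℕ) (z : Ambient m) : ℝ := z.1.1

/-- The restriction of the projection to the hypersurface. -/
def height (m : ℕ) (c₁ c₂ : ℝ → ℝ) : hypersurface m c₁ c₂ → ℝ := fun z => proj m z

/-- The vertex set: the points of the Reeb space of the height function that are given by
critical contours, that is, by contours containing a critical point. -/
def reebVertices (m : ℕ) (c₁ c₂ : ℝ → ℝ) : Set (ReebSpace (height m c₁ c₂)) :=
  {q | ∃ z : hypersurface m c₁ c₂,
    IsCriticalPointOn (hypersurface m c₁ c₂) (proj m) z ∧ reebMk (height m c₁ c₂) z = q}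

end Region

end ReebTS

/-! Over a point of the closed strip `c x₂ ≤ x₁ ≤ c x₂ + a` (with `c = c₁`) the hypersurface is a
sphere whose radius vanishes exactly on the boundary of the strip. A contour of the height is
therefore the preimage of a maximal interval of a line `x₁ = p` inside the strip (`reebMk_eq_iff`).
For `m ≥ 3` the spheres are connected. For `m = 2` they are pairs of points, and the two sheets over
an interval are joined at a boundary point, which exists because no line lies in the open region. So
the Reeb space is the space of these intervals, and only the strip matters (`IsStripReeb`). A point
of the hypersurface is critical exactly when it lies over a boundary point of the strip with `x₂` in
the critical set `S` (`isCriticalPointOn_iff`).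

Values of `c` on consecutive components of `S` differ by more than `a`, while `c` varies by at most
`a` along a contour. Hence a contour meets at most one component of `S` (`uIcc_subset_of_level`). If
`c` has the value `v` on a component, the contours over it at levels in `[v, v + a]` form an arc
from a low vertex up to a high vertex: the closure of a core edge. Over a bounded gap of `S` on
which `c` rises from `v` to `v'`, one has `v + a < v'`, and the contours that stay off `S` are those
at levels strictly between `v + a` and `v'`. They form an open arc from the high vertex on the left
to the low vertex on the right. An unbounded gap gives a half-line in the same way, and decreasing
gaps are reduced to increasing ones by reflection (`isMonotoneEdge_gapEdge`).

Each contour has an open neighbourhood (`starNhd`) that meets at most one core edge and one gap edge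
on each side. This gives local finiteness, from which the weak topology and local compactness
follow, and it bounds the degree by 3. Along each edge the induced function is injective, which
orients the edge. At a low vertex the core edge goes up and any gap edge goes down; at a high vertex
it is the other way round. So a vertex with a gap edge is not a local extremum, and an extremum has
only its core edge. -/

namespace ReebTS

/-! ### Tame functions of one variable and the stars of points of `S` -/

/-- A continuous function `c` together with a closed set `S` such that `c` is constant on the
intervals in `S` and strictly monotone on the intervals off `S`, where the values of `c` at the
two ends of a gap of `S` differ by more than `a`. -/
structure IsTame (c : ℝ → ℝ) (S : Set ℝ) (a : ℝ) : Prop where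
  pos : 0 < a
  cont : Continuous c
  closed : IsClosed S
  nonempty : S.Nonempty
  const : ∀ x y, uIcc x y ⊆ S → c x = c y
  mono : ∀ I : Set ℝ, I.OrdConnected → Disjoint (interior I) S →
    StrictMonoOn c I ∨ StrictAntiOn c I
  gap : ∀ x y, x < y → x ∈ S → y ∈ S → (∀ t ∈ Ioo x y, t ∉ S) → a < |c x - c y|

/-- The points that can be joined to `s` without meeting points of `S` at which `c` takes a
value other than `c s`. -/
def star (c : ℝ → ℝ) (S : Set ℝ) (s : ℝ) : Set ℝ :=
  {t | ∀ r ∈ uIcc s t, r ∈ S → c r = c s}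

theorem exists_last_mem {S : Set ℝ} (hS : IsClosed S) {s t : ℝ} (hs : s ∈ S) (hst : s ≤ t) :
    ∃ x ∈ S, s ≤ x ∧ x ≤ t ∧ ∀ r ∈ Ioc x t, r ∉ S := by
  have hK : IsCompact (S ∩ Icc s t) := isCompact_Icc.inter_left hS
  obtain ⟨x, hx, hmax⟩ := hK.exists_isGreatest ⟨s, hs, le_rfl, hst⟩
  refine ⟨x, hx.1, hx.2.1, hx.2.2, fun r hr hrS => ?_⟩
  exact absurd (hmax ⟨hrS, hx.2.1.trans hr.1.le, hr.2⟩) (not_le.2 hr.1)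

theorem exists_first_mem {S : Set ℝ} (hS : IsClosed S) {s t : ℝ} (hs : s ∈ S) (hst : t ≤ s) :
    ∃ x ∈ S, t ≤ x ∧ x ≤ s ∧ ∀ r ∈ Ico t x, r ∉ S := by
  have hK : IsCompact (S ∩ Icc t s) := isCompact_Icc.inter_left hS
  obtain ⟨x, hx, hmin⟩ := hK.exists_isLeast ⟨s, hs, hst, le_rfl⟩
  refine ⟨x, hx.1, hx.2.1, hx.2.2, fun r hr hrS => ?_⟩
  exact absurd (hmin ⟨hrS, hr.1, hr.2.le.trans hx.2.2⟩) (not_le.2 hr.2)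

namespace IsTame

variable {c : ℝ → ℝ} {S : Set ℝ} {a : ℝ}

/-- This symmetry and `neg_sub` match the reflections of the strip, so that only gaps to the right
of a point of `S` on which `c` increases need a direct treatment. -/
theorem comp_neg (h : IsTame c S a) : IsTame (fun t => c (-t)) {t | -t ∈ S} a where
  pos := h.pos
  cont := h.cont.comp continuous_neg
  closed := h.closed.preimage continuous_neg
  nonempty := by
    obtain ⟨s, hs⟩ := h.nonempty
    exact ⟨-s, by simpa using hs⟩
  const x y hxy := by
    refine h.const _ _ fun r hr => ?_
    have : -r ∈ uIcc x y := by
      rw [mem_uIcc] at hr ⊢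
      rcases hr with hr | hr
      · right; constructor <;> linarith
      · left; constructor <;> linarith
    simpa using hxy this
  mono I hI hd := by
    have h1 : OrdConnected {t : ℝ | -t ∈ I} :=
      hI.preimage_anti fun x y hxy => neg_le_neg hxy
    have h2 : interior {t : ℝ | -t ∈ I} = {t | -t ∈ interior I} :=
      ((Homeomorph.neg ℝ).preimage_interior I).symm
    have h3 : Disjoint (interior {t : ℝ | -t ∈ I}) S := by
      rw [h2, Set.disjoint_left]
      intro t ht hS
      exact Set.disjoint_left.1 hd ht (by simpa using hS)
    rcases h.mono _ h1 h3 with h4 | h4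
    · right
      intro x hx y hy hxy
      exact h4 (by simpa using hy) (by simpa using hx) (neg_lt_neg hxy)
    · left
      intro x hx y hy hxy
      exact h4 (by simpa using hy) (by simpa using hx) (neg_lt_neg hxy)
  gap x y hxy hx hy hd := by
    rw [abs_sub_comm]
    refine h.gap (-y) (-x) (by linarith) hy hx fun t ht hS => ?_
    exact hd (-t) ⟨by linarith [ht.2], by linarith [ht.1]⟩ (by simpa using hS)

theorem neg_sub (h : IsTame c S a) : IsTame (fun t => -c t - a) S a where
  pos := h.pos
  cont := h.cont.neg.sub continuous_const
  closed := h.closed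
  nonempty := h.nonempty
  const x y hxy := by simp [h.const x y hxy]
  mono I hI hd := by
    rcases h.mono I hI hd with h4 | h4
    · right
      intro x hx y hy hxy
      have := h4 hx hy hxy
      simp only; linarith
    · left
      intro x hx y hy hxy
      have := h4 hx hy hxy
      simp only; linarith
  gap x y hxy hx hy hd := by
    have := h.gap x y hxy hx hy hd
    rw [abs_sub_comm] at this
    convert this using 2
    ring

/-- A point of the interval off `S` would lie in a gap whose two ends also belong to the interval,
and the values at these ends differ by more than `a`. -/
theorem Icc_subset (h : IsTame c S a) {s s' : ℝ} (hs : s ∈ S) (hs' : s' ∈ S)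
    (hv : ∀ r ∈ Icc s s', ∀ r' ∈ Icc s s', r ∈ S → r' ∈ S → |c r - c r'| ≤ a) :
    Icc s s' ⊆ S := by
  intro r hr
  by_contra hrS
  obtain ⟨x, hx, hsx, hxr, hx'⟩ := exists_last_mem h.closed hs hr.1
  obtain ⟨y, hy, hry, hys, hy'⟩ := exists_first_mem h.closed hs' hr.2
  have hxr' : x < r := lt_of_le_of_ne hxr fun e => hrS (e ▸ hx)
  have hry' : r < y := lt_of_le_of_ne hry fun e => hrS (e ▸ hy)
  refine absurd (hv x ⟨hsx, by linarith⟩ y ⟨by linarith, hys⟩ hx hy)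
    (not_le.2 (h.gap x y (by linarith) hx hy fun t ht => ?_))
  rcases le_total t r with htr | htr
  · exact hx' t ⟨ht.1, htr⟩
  · exact hy' t ⟨htr, ht.2⟩

theorem uIcc_subset (h : IsTame c S a) {s s' : ℝ} (hs : s ∈ S) (hs' : s' ∈ S)
    (hv : ∀ r ∈ uIcc s s', ∀ r' ∈ uIcc s s', r ∈ S → r' ∈ S → |c r - c r'| ≤ a) :
    uIcc s s' ⊆ S := by
  rcases le_total s s' with hle | hle
  · rw [uIcc_of_le hle] at hv ⊢
    exact h.Icc_subset hs hs' hv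
  · rw [uIcc_of_ge hle] at hv ⊢
    exact h.Icc_subset hs' hs hv

/-- Two points of `S` that lie in one component of a set `{r | p - a ≤ c r ≤ p}` lie in
one component of `S`. -/
theorem uIcc_subset_of_level (h : IsTame c S a) {s s' p : ℝ} (hs : s ∈ S) (hs' : s' ∈ S)
    (hv : ∀ r ∈ uIcc s s', c r ≤ p ∧ p ≤ c r + a) : uIcc s s' ⊆ S :=
  h.uIcc_subset hs hs' fun r hr r' hr' _ _ => by
    have := hv r hr
    have := hv r' hr'
    rw [abs_le]; constructor <;> linarith

theorem eq_of_level (h : IsTame c S a) {s s' p : ℝ} (hs : s ∈ S) (hs' : s' ∈ S)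
    (hv : ∀ r ∈ uIcc s s', c r ≤ p ∧ p ≤ c r + a) : c s = c s' :=
  h.const _ _ (h.uIcc_subset_of_level hs hs' hv)

theorem uIcc_subset_of_mem_star (h : IsTame c S a) {s s' : ℝ} (hs : s ∈ S) (hs' : s' ∈ S)
    (hst : s' ∈ star c S s) : uIcc s s' ⊆ S :=
  h.uIcc_subset hs hs' fun r hr r' hr' hrS hrS' => by
    rw [hst r hr hrS, hst r' hr' hrS', sub_self, abs_zero]
    exact h.pos.le

/-- Up to the last point `x` of `S` before `t` the function keeps the value `c s`; from `x` to `t`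
there are no further points of `S`, so it is strictly monotone. -/
theorem mem_uIcc_of_mem_star_of_le (h : IsTame c S a) {s t r : ℝ} (hs : s ∈ S) (hst : s ≤ t)
    (ht : t ∈ star c S s) (hr : r ∈ Icc s t) : c r ∈ uIcc (c s) (c t) := by
  obtain ⟨x, hx, hsx, hxt, hx'⟩ := exists_last_mem h.closed hs hst
  have hsub : uIcc s x ⊆ uIcc s t := by
    rw [uIcc_of_le hsx, uIcc_of_le hst]
    exact Icc_subset_Icc_right hxt
  have hxst : x ∈ star c S s := fun r hr => ht r (hsub hr)
  have hS := h.uIcc_subset_of_mem_star hs hx hxst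
  have hcx : c s = c x := h.const _ _ hS
  rcases le_total r x with hrx | hrx
  · have : c r = c s := ht r (by rwa [uIcc_of_le hst])
      (hS (by rw [uIcc_of_le hsx]; exact ⟨hr.1, hrx⟩))
    rw [this]; exact left_mem_uIcc
  · rw [hcx]
    have hd : Disjoint (interior (Icc x t)) S := by
      rw [interior_Icc, Set.disjoint_left]
      exact fun u hu => hx' u ⟨hu.1, hu.2.le⟩
    rcases h.mono _ (ordConnected_Icc) hd with hm | hm
    · exact mem_uIcc_of_le (hm.monotoneOn ⟨le_rfl, hxt⟩ ⟨hrx, hr.2⟩ hrx)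
        (hm.monotoneOn ⟨hrx, hr.2⟩ ⟨hxt, le_rfl⟩ hr.2)
    · exact mem_uIcc_of_ge (hm.antitoneOn ⟨hrx, hr.2⟩ ⟨hxt, le_rfl⟩ hr.2)
        (hm.antitoneOn ⟨le_rfl, hxt⟩ ⟨hrx, hr.2⟩ hrx)

theorem mem_uIcc_of_mem_star (h : IsTame c S a) {s t r : ℝ} (hs : s ∈ S)
    (ht : t ∈ star c S s) (hr : r ∈ uIcc s t) : c r ∈ uIcc (c s) (c t) := by
  rcases le_total s t with hst | hst
  · rw [uIcc_of_le hst] at hr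
    exact h.mem_uIcc_of_mem_star_of_le hs hst ht hr
  · rw [uIcc_of_ge hst] at hr
    have := h.comp_neg.mem_uIcc_of_mem_star_of_le (s := -s) (t := -t) (r := -r)
      (by simpa using hs) (by linarith) ?_ ⟨by linarith [hr.2], by linarith [hr.1]⟩
    · simpa using this
    · intro u hu huS
      simp only [neg_neg]
      refine ht (-u) ?_ huS
      rw [uIcc_of_le (by linarith)] at hu
      rw [uIcc_of_ge hst]
      exact ⟨by linarith [hu.2], by linarith [hu.1]⟩

theorem mem_star_of_uIcc_disjoint {s t t' : ℝ} (ht : t ∈ star c S s)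
    (hd : ∀ r ∈ uIcc t t', r ∉ S) : t' ∈ star c S s := by
  intro r hr hrS
  rcases uIcc_subset_uIcc_union_uIcc (b := t) hr with h1 | h1
  · exact ht r h1 hrS
  · exact absurd hrS (hd r h1)

theorem star_trans {s t t' : ℝ} (ht : t ∈ star c S s) (hct : c t = c s)
    (ht' : t' ∈ star c S t) : t' ∈ star c S s := by
  intro r hr hrS
  rcases uIcc_subset_uIcc_union_uIcc (b := t) hr with h1 | h1
  · exact ht r h1 hrS
  · rw [ht' r h1 hrS, hct]

theorem isOpen_star (h : IsTame c S a) (s : ℝ) : IsOpen (star c S s) := by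
  rw [isOpen_iff_mem_nhds]
  intro t ht
  by_cases htS : t ∈ S
  · have hct : c t = c s := ht t right_mem_uIcc htS
    -- On an interval where `c` stays within `a / 2` of `c t`, all values lie in a window of length
    -- `a`, so the points of `S` there share the component, and the value, of `t`.
    have hU : {r | |c r - c t| < a / 2} ∈ 𝓝 t := by
      refine (isOpen_lt ((h.cont.sub continuous_const).abs) continuous_const).mem_nhds ?_
      simpa using half_pos h.pos
    obtain ⟨l, u, htlu, hlu⟩ := mem_nhds_iff_exists_Ioo_subset.1 hU
    filter_upwards [Ioo_mem_nhds htlu.1 htlu.2] with t' ht'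
    refine star_trans ht hct fun r hr hrS => ?_
    have hsub : ∀ r' ∈ uIcc t r, r' ∈ Ioo l u := fun r' hr' =>
      (ordConnected_Ioo.uIcc_subset htlu
        (ordConnected_Ioo.uIcc_subset htlu ht' hr)) hr'
    refine (h.eq_of_level (p := c t + a / 2) htS hrS fun r' hr' => ?_).symm
    have := hlu (hsub r' hr')
    rw [mem_ofPred_eq, abs_lt] at this
    constructor <;> linarith
  · obtain ⟨l, u, htlu, hlu⟩ :=
      mem_nhds_iff_exists_Ioo_subset.1 (h.closed.isOpen_compl.mem_nhds htS)
    filter_upwards [Ioo_mem_nhds htlu.1 htlu.2] with t' ht'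
    exact mem_star_of_uIcc_disjoint ht fun r hr =>
      hlu (ordConnected_Ioo.uIcc_subset htlu ht' hr)

/-- Points of the star of `s` off `S` on the same side of `s` lie in one gap of `S`. -/
theorem uIcc_disjoint_of_mem_star (h : IsTame c S a) {s t t' : ℝ} (hs : s ∈ S)
    (ht : t ∈ star c S s) (ht' : t' ∈ star c S s) (htS : t ∉ S) (htS' : t' ∉ S)
    (hside : s ≤ t ∧ s ≤ t' ∨ t ≤ s ∧ t' ≤ s) : ∀ r ∈ uIcc t t', r ∉ S := by
  have key : ∀ t t', t ∉ S → t' ∈ star c S s → (s ≤ t ∧ t ≤ t' ∨ t' ≤ t ∧ t ≤ s) →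
      ∀ r ∈ uIcc t t', r ∉ S := by
    intro t t' htS ht' hside r hr hrS
    have hr' : r ∈ uIcc s t' ∧ t ∈ uIcc s r := by
      simp only [mem_uIcc] at hr ⊢
      rcases hside with hh | hh <;> rcases hr with hr | hr
      · exact ⟨Or.inl ⟨by linarith, by linarith⟩, Or.inl ⟨by linarith, by linarith⟩⟩
      · exact ⟨Or.inl ⟨by linarith, by linarith⟩, Or.inl ⟨by linarith, by linarith⟩⟩
      · exact ⟨Or.inr ⟨by linarith, by linarith⟩, Or.inr ⟨by linarith, by linarith⟩⟩
      · exact ⟨Or.inr ⟨by linarith, by linarith⟩, Or.inr ⟨by linarith, by linarith⟩⟩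
    have hst : r ∈ star c S s := fun u hu =>
      ht' u (uIcc_subset_uIcc left_mem_uIcc hr'.1 hu)
    -- A point `r` of `S` beyond `t` in the star would lie in the same component of `S` as `s`, and
    -- `t`, being between them, would be in `S`.
    exact htS (h.uIcc_subset_of_mem_star hs hrS hst hr'.2)
  rcases le_total t t' with hle | hle <;> rcases hside with ⟨h1, h2⟩ | ⟨h1, h2⟩
  · exact key t t' htS ht' (Or.inl ⟨h1, hle⟩)
  · rw [uIcc_comm]; exact key t' t htS' ht (Or.inr ⟨hle, h2⟩)
  · rw [uIcc_comm]; exact key t' t htS' ht (Or.inl ⟨h2, hle⟩)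
  · exact key t t' htS ht' (Or.inr ⟨hle, h1⟩)

theorem exists_mem_star (h : IsTame c S a) (t : ℝ) : ∃ s ∈ S, t ∈ star c S s := by
  obtain ⟨s₀, hs₀⟩ := h.nonempty
  rcases le_total s₀ t with hle | hle
  · obtain ⟨x, hx, -, hxt, hx'⟩ := exists_last_mem h.closed hs₀ hle
    refine ⟨x, hx, fun r hr hrS => ?_⟩
    rw [uIcc_of_le hxt] at hr
    rcases hr.1.eq_or_lt with he | he
    · rw [he]
    · exact absurd hrS (hx' r ⟨he, hr.2⟩)
  · obtain ⟨x, hx, hxt, -, hx'⟩ := exists_first_mem h.closed hs₀ hle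
    refine ⟨x, hx, fun r hr hrS => ?_⟩
    rw [uIcc_of_ge hxt] at hr
    rcases hr.2.eq_or_lt with he | he
    · rw [he]
    · exact absurd hrS (hx' r ⟨hr.1, he⟩)

end IsTame

/-! ### The strip, its vertices and its open edges -/

/-- The closed strip between the graphs of `c` and `c + a`. -/
def strip (c : ℝ → ℝ) (a : ℝ) : Set (ℝ × ℝ) := {w | c w.2 ≤ w.1 ∧ w.1 ≤ c w.2 + a}

/-- `π` is a model of the Reeb quotient map of the first coordinate on the strip, and `g` is the
induced function. -/
structure IsStripReeb {R : Type*} [TopologicalSpace R] (c : ℝ → ℝ) (a : ℝ) (π : ℝ × ℝ → R)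
    (g : R → ℝ) : Prop where
  contOn : ContinuousOn π (strip c a)
  surj : ∀ q, ∃ w ∈ strip c a, π w = q
  -- This is the quotient topology, phrased so that openness in `R` can be verified with an open set
  -- of the plane.
  isOpen : ∀ (U : Set R) (O : Set (ℝ × ℝ)), IsOpen O → (∀ w ∈ strip c a, π w ∈ U ↔ w ∈ O) →
    IsOpen U
  eq_iff : ∀ w ∈ strip c a, ∀ w' ∈ strip c a,
    (π w = π w' ↔ w.1 = w'.1 ∧ ∀ r ∈ uIcc w.2 w'.2, (w.1, r) ∈ strip c a)
  val : ∀ w ∈ strip c a, g (π w) = w.1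

/-- The points of the Reeb space at the lower boundary of the strip over `S`. -/
def lows {R : Type*} (c : ℝ → ℝ) (S : Set ℝ) (π : ℝ × ℝ → R) : Set R :=
  (fun s => π (c s, s)) '' S

/-- The points of the Reeb space at the upper boundary of the strip over `S`. -/
def highs {R : Type*} (c : ℝ → ℝ) (S : Set ℝ) (a : ℝ) (π : ℝ × ℝ → R) : Set R :=
  (fun s => π (c s + a, s)) '' S

/-- The open edge of contours through the segment over `s`. -/
def coreEdge {R : Type*} (c : ℝ → ℝ) (a : ℝ) (π : ℝ × ℝ → R) (s : ℝ) : Set R :=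
  (fun p => π (p, s)) '' Ioo (c s) (c s + a)

/-- The open edge of contours in the part of the strip over the gap of `S` through `t`. -/
def gapEdge {R : Type*} (c : ℝ → ℝ) (S : Set ℝ) (a : ℝ) (π : ℝ × ℝ → R) (t : ℝ) : Set R :=
  {q | ∃ w ∈ strip c a, π w = q ∧ (∀ r ∈ uIcc t w.2, r ∉ S) ∧
    ∀ s ∈ S, (w.1, s) ∈ strip c a → π (w.1, s) ≠ q}

/-- The points of the Reeb space all of whose representatives lie over the star of `s`. -/
def starNhd {R : Type*} (c : ℝ → ℝ) (S : Set ℝ) (a : ℝ) (π : ℝ × ℝ → R) (s : ℝ) : Set R :=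
  {q | ∀ w ∈ strip c a, π w = q → w.2 ∈ star c S s}

section Edges

variable {R : Type*} {c : ℝ → ℝ} {S : Set ℝ} {a : ℝ} {π : ℝ × ℝ → R}

theorem mem_star_of_coreEdge {s s' : ℝ}
    (hne : (coreEdge c a π s' ∩ starNhd c S a π s).Nonempty) : s' ∈ star c S s := by
  obtain ⟨q, ⟨p, hp, rfl⟩, hq⟩ := hne
  exact hq (p, s') ⟨hp.1.le, hp.2.le⟩ rfl

theorem mem_star_of_gapEdge {s t : ℝ}
    (hne : (gapEdge c S a π t ∩ starNhd c S a π s).Nonempty) : t ∈ star c S s := by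
  obtain ⟨q, ⟨w, hw, he, hd, -⟩, hq⟩ := hne
  exact IsTame.mem_star_of_uIcc_disjoint (hq w hw he) fun r hr => hd r (by rwa [uIcc_comm])

theorem gapEdge_subset {t t' : ℝ} (hd : ∀ r ∈ uIcc t t', r ∉ S) :
    gapEdge c S a π t ⊆ gapEdge c S a π t' := by
  rintro q ⟨w, hw, he, hd', hS⟩
  refine ⟨w, hw, he, fun r hr => ?_, hS⟩
  rcases uIcc_subset_uIcc_union_uIcc (b := t) hr with h1 | h1
  · exact hd r (by rwa [uIcc_comm])
  · exact hd' r h1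

theorem gapEdge_eq {t t' : ℝ} (hd : ∀ r ∈ uIcc t t', r ∉ S) :
    gapEdge c S a π t = gapEdge c S a π t' :=
  (gapEdge_subset hd).antisymm (gapEdge_subset fun r hr => hd r (by rwa [uIcc_comm]))

/-- At most two gap edges lie next to a point of `S`. -/
theorem encard_gapEdges_le (h : IsTame c S a) {s : ℝ} (hs : s ∈ S) :
    {e | ∃ t ∈ star c S s, t ∉ S ∧ e = gapEdge c S a π t}.encard ≤ 2 := by
  have hsub : ∀ P : ℝ → Prop, (∀ t t', P t → P t' → s ≤ t ∧ s ≤ t' ∨ t ≤ s ∧ t' ≤ s) →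
      {e | ∃ t ∈ star c S s, t ∉ S ∧ P t ∧ e = gapEdge c S a π t}.encard ≤ 1 := by
    intro P hP
    rw [encard_le_one_iff]
    rintro e e' ⟨t, ht, htS, htP, rfl⟩ ⟨t', ht', htS', htP', rfl⟩
    exact gapEdge_eq (h.uIcc_disjoint_of_mem_star hs ht ht' htS htS' (hP t t' htP htP'))
  have h1 := hsub (fun t => s ≤ t) fun t t' h1 h2 => Or.inl ⟨h1, h2⟩
  have h2 := hsub (fun t => t ≤ s) fun t t' h1 h2 => Or.inr ⟨h1, h2⟩
  calc _ ≤ _ := encard_le_encard (t := _ ∪ _) ?_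
    _ ≤ _ := encard_union_le _ _
    _ ≤ 1 + 1 := add_le_add h1 h2
    _ = 2 := one_add_one_eq_two
  rintro e ⟨t, ht, htS, rfl⟩
  rcases le_total s t with hle | hle
  · exact Or.inl ⟨t, ht, htS, hle, rfl⟩
  · exact Or.inr ⟨t, ht, htS, hle, rfl⟩

end Edges

/-! ### Topology of the Reeb space of the strip -/

namespace IsStripReeb

variable {R : Type*} [TopologicalSpace R] {c : ℝ → ℝ} {S : Set ℝ} {a : ℝ} {π : ℝ × ℝ → R}
  {g : R → ℝ}

theorem isClosed_strip (hc : Continuous c) : IsClosed (strip c a) :=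
  (isClosed_le (hc.comp continuous_snd) continuous_fst).inter
    (isClosed_le continuous_fst ((hc.comp continuous_snd).add continuous_const))

theorem continuous_val (hR : IsStripReeb c a π g) : Continuous g := by
  rw [continuous_def]
  intro U hU
  refine hR.isOpen _ _ (hU.preimage continuous_fst) fun w hw => ?_
  simp [hR.val w hw]

theorem eq_of_uIcc (hR : IsStripReeb c a π g) {p t t' : ℝ}
    (h : ∀ r ∈ uIcc t t', (p, r) ∈ strip c a) : π (p, t) = π (p, t') :=
  (hR.eq_iff _ (h _ left_mem_uIcc) _ (h _ right_mem_uIcc)).2 ⟨rfl, h⟩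

/-- A contour fails to reach `[x, ∞)` exactly when, going up from one of its points, an obstacle
outside the strip occurs no later than `x`. Since the strip is closed, having such an obstacle is an
open condition on the point. -/
theorem isClosed_image_ge (hR : IsStripReeb c a π g) (hc : Continuous c) (x : ℝ) :
    IsClosed (π '' {w | w ∈ strip c a ∧ x ≤ w.2}) := by
  have hO : IsOpen {w : ℝ × ℝ | ∃ r, (w.1, r) ∉ strip c a ∧ w.2 < r ∧ r ≤ x} := by
    have : {w : ℝ × ℝ | ∃ r, (w.1, r) ∉ strip c a ∧ w.2 < r ∧ r ≤ x} =
        ⋃ r ∈ Iic x, {w : ℝ × ℝ | (w.1, r) ∉ strip c a ∧ w.2 < r} := by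
      ext w; simp only [mem_iUnion, mem_ofPred_eq, mem_Iic, exists_prop]
      exact ⟨fun ⟨r, h1, h2, h3⟩ => ⟨r, h3, h1, h2⟩, fun ⟨r, h1, h2, h3⟩ => ⟨r, h2, h3, h1⟩⟩
    rw [this]
    refine isOpen_biUnion fun r _ => IsOpen.inter ?_ (isOpen_lt continuous_snd continuous_const)
    exact (isClosed_strip hc).isOpen_compl.preimage (continuous_fst.prodMk continuous_const)
  rw [← isOpen_compl_iff]
  refine hR.isOpen _ _ hO fun w hw => ?_
  constructor
  · intro hq
    by_contra hcon
    simp only [mem_ofPred_eq, not_exists, not_and, not_le] at hcon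
    refine hq ⟨(w.1, max w.2 x), ⟨?_, le_max_right _ _⟩, ?_⟩
    · by_contra hns
      rcases le_total w.2 x with hle | hle
      · rw [max_eq_right hle] at hns
        rcases hle.eq_or_lt with he | he
        · exact hns (he ▸ hw)
        · exact absurd (hcon x hns he) (lt_irrefl _)
      · rw [max_eq_left hle] at hns
        exact hns hw
    · refine (hR.eq_of_uIcc fun r hr => ?_).symm
      rw [uIcc_of_le (le_max_left _ _)] at hr
      by_contra hns
      rcases hr.1.eq_or_lt with he | he
      · exact hns (he ▸ hw)
      · rcases le_total w.2 x with hle | hle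
        · rw [max_eq_right hle] at hr
          exact absurd (hcon r hns he) (not_lt.2 hr.2)
        · rw [max_eq_left hle] at hr
          exact absurd he (not_lt.2 hr.2)
  · rintro ⟨r, hr, hwr, hrx⟩ ⟨w', ⟨hw', hxw'⟩, he⟩
    obtain ⟨-, h2⟩ := (hR.eq_iff w hw w' hw').1 he.symm
    exact hr (h2 r (mem_uIcc_of_le hwr.le (hrx.trans hxw')))

/-- The reflection of the second coordinate. -/
theorem reflect_snd (hR : IsStripReeb c a π g) :
    IsStripReeb (fun t => c (-t)) a (fun w => π (w.1, -w.2)) g where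
  contOn := hR.contOn.comp (by fun_prop) fun w hw => hw
  surj q := by
    obtain ⟨w, hw, rfl⟩ := hR.surj q
    exact ⟨(w.1, -w.2), by simpa [strip] using hw, by simp⟩
  isOpen U O hO h := by
    refine hR.isOpen U ((fun w => (w.1, -w.2)) ⁻¹' O) (hO.preimage (by fun_prop)) fun w hw => ?_
    have := h (w.1, -w.2) (by simpa [strip] using hw)
    simpa using this
  eq_iff w hw w' hw' := by
    rw [hR.eq_iff _ hw _ hw']
    refine and_congr_right fun _ => ⟨fun H r hr => ?_, fun H r hr => ?_⟩
    · refine H (-r) ?_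
      rw [mem_uIcc] at hr ⊢
      rcases hr with hr | hr
      · right; constructor <;> simp only <;> linarith
      · left; constructor <;> simp only <;> linarith
    · have := H (-r) (by
        rw [mem_uIcc] at hr ⊢
        rcases hr with hr | hr
        · right; simp only at hr; constructor <;> linarith
        · left; simp only at hr; constructor <;> linarith)
      simpa [strip] using this
  val w hw := hR.val _ hw

theorem mem_strip_neg {w : ℝ × ℝ} : w ∈ strip (fun t => -c t - a) a ↔ (-w.1, w.2) ∈ strip c a := by
  simp only [strip, mem_ofPred_eq]
  constructor <;> rintro ⟨h1, h2⟩ <;> constructor <;> linarith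

/-- The reflection of the first coordinate. -/
theorem reflect_fst (hR : IsStripReeb c a π g) :
    IsStripReeb (fun t => -c t - a) a (fun w => π (-w.1, w.2)) (fun q => -g q) where
  contOn := hR.contOn.comp (by fun_prop) fun w hw => mem_strip_neg.1 hw
  surj q := by
    obtain ⟨w, hw, rfl⟩ := hR.surj q
    exact ⟨(-w.1, w.2), mem_strip_neg.2 (by simpa using hw), by simp⟩
  isOpen U O hO h := by
    refine hR.isOpen U ((fun w => (-w.1, w.2)) ⁻¹' O) (hO.preimage (by fun_prop)) fun w hw => ?_
    have := h (-w.1, w.2) (mem_strip_neg.2 (by simpa using hw))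
    simpa using this
  eq_iff w hw w' hw' := by
    rw [hR.eq_iff _ (mem_strip_neg.1 hw) _ (mem_strip_neg.1 hw')]
    simp only [mem_strip_neg, neg_inj]
  val w hw := by
    have := hR.val _ (mem_strip_neg.1 hw)
    simp [this]

theorem isClosed_image_le (hR : IsStripReeb c a π g) (hc : Continuous c) (x : ℝ) :
    IsClosed (π '' {w | w ∈ strip c a ∧ w.2 ≤ x}) := by
  convert hR.reflect_snd.isClosed_image_ge (hc.comp continuous_neg) (-x) using 1
  ext q
  constructor
  · rintro ⟨w, ⟨hw, hx⟩, rfl⟩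
    exact ⟨(w.1, -w.2), ⟨by simpa [strip] using hw, neg_le_neg hx⟩, by simp⟩
  · rintro ⟨w, ⟨hw, hx⟩, rfl⟩
    exact ⟨(w.1, -w.2), ⟨by simpa [strip] using hw, by simp only; linarith⟩, by simp⟩

/-- Contours at different levels are separated by `g`. Two contours at one level have between them a
point `r` at which the line leaves the strip. The contours lying entirely below `r` and those lying
entirely above it form disjoint open sets. -/
theorem t2Space (hR : IsStripReeb c a π g) (hc : Continuous c) : T2Space R := by
  have key : ∀ p t t', t ≤ t' → (p, t) ∈ strip c a → (p, t') ∈ strip c a →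
      π (p, t) ≠ π (p, t') →
      ∃ U V : Set R, IsOpen U ∧ IsOpen V ∧ π (p, t) ∈ U ∧ π (p, t') ∈ V ∧ Disjoint U V := by
    intro p t t' hle hw hw' hne
    obtain ⟨r, hr, hrs⟩ : ∃ r ∈ Icc t t', (p, r) ∉ strip c a := by
      by_contra! hcon
      exact hne (hR.eq_of_uIcc (by rwa [uIcc_of_le hle]))
    refine ⟨_, _, (hR.isClosed_image_ge hc r).isOpen_compl, (hR.isClosed_image_le hc r).isOpen_compl,
      ?_, ?_, ?_⟩
    · rintro ⟨u, ⟨hu, hru⟩, he⟩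
      obtain ⟨h1, h2⟩ := (hR.eq_iff _ hw _ hu).1 he.symm
      exact hrs (h2 r (mem_uIcc_of_le hr.1 hru))
    · rintro ⟨u, ⟨hu, hru⟩, he⟩
      obtain ⟨h1, h2⟩ := (hR.eq_iff _ hw' _ hu).1 he.symm
      exact hrs (h2 r (mem_uIcc_of_ge hru hr.2))
    · rw [disjoint_compl_left_iff_subset, compl_subset_iff_union, ← image_union, eq_univ_iff_forall]
      intro q
      obtain ⟨u, hu, rfl⟩ := hR.surj q
      refine ⟨u, ?_, rfl⟩
      rcases le_total r u.2 with h | h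
      · exact Or.inr ⟨hu, h⟩
      · exact Or.inl ⟨hu, h⟩
  refine ⟨fun q q' hne => ?_⟩
  by_cases hg : g q = g q'
  · obtain ⟨⟨p, t⟩, hw, rfl⟩ := hR.surj q
    obtain ⟨⟨p', t'⟩, hw', rfl⟩ := hR.surj q'
    rw [hR.val _ hw, hR.val _ hw'] at hg
    obtain rfl : p = p' := hg
    rcases le_total t t' with hle | hle
    · exact key p t t' hle hw hw' hne
    · obtain ⟨U, V, hU, hV, h1, h2, hd⟩ := key p t' t hle hw' hw hne.symm
      exact ⟨V, U, hV, hU, h2, h1, hd.symm⟩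
  · obtain ⟨U, V, hU, hV, h1, h2, hd⟩ := t2_separation hg
    exact ⟨_, _, hU.preimage hR.continuous_val, hV.preimage hR.continuous_val, h1, h2,
      hd.preimage g⟩

theorem connectedSpace (hR : IsStripReeb c a π g) (hc : Continuous c) (ha : 0 ≤ a) :
    ConnectedSpace R := by
  have himg : π '' strip c a = univ := by
    rw [eq_univ_iff_forall]
    exact hR.surj
  rw [connectedSpace_iff_univ, ← himg]
  refine IsConnected.image ?_ _ hR.contOn
  -- Shearing by `c` straightens the strip to a product of connected sets.
  have : strip c a = (fun u : ℝ × ℝ => (c u.2 + u.1, u.2)) '' (Icc 0 a ×ˢ univ) := by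
    ext w
    constructor
    · rintro ⟨h1, h2⟩
      exact ⟨(w.1 - c w.2, w.2), ⟨⟨by simp only; linarith, by simp only; linarith⟩, trivial⟩,
        by simp⟩
    · rintro ⟨u, ⟨⟨h1, h2⟩, -⟩, rfl⟩
      constructor <;> simp only <;> linarith
  rw [this]
  refine IsConnected.image ((isConnected_Icc ha).prod isConnected_univ) _ ?_
  exact Continuous.continuousOn (by fun_prop)

/-- A closed upper set of reals is empty, a closed ray or the whole line. -/
theorem isClosed_image_of_isUpperSet (hR : IsStripReeb c a π g) (hc : Continuous c) {C : Set ℝ}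
    (hC : IsClosed C) (hC' : IsUpperSet C) : IsClosed (π '' {w | w ∈ strip c a ∧ w.2 ∈ C}) := by
  by_cases hb : C.Nonempty ∧ BddBelow C
  · have : C = Ici (sInf C) := by
      refine Subset.antisymm (fun t ht => csInf_le hb.2 ht) fun t ht => ?_
      exact hC' ht (hC.csInf_mem hb.1 hb.2)
    have key := hR.isClosed_image_ge hc (sInf C)
    rw [this]
    exact key
  · rcases C.eq_empty_or_nonempty with he | hne
    · simp [he]
    · have hu : C = univ := by
        rw [eq_univ_iff_forall]
        intro t
        by_contra ht
        refine hb ⟨hne, t, fun u hu => ?_⟩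
        by_contra hlt
        exact ht (hC' (not_le.1 hlt).le hu)
      have : π '' {w | w ∈ strip c a ∧ w.2 ∈ C} = univ := by
        rw [eq_univ_iff_forall]
        intro q
        obtain ⟨w, hw, rfl⟩ := hR.surj q
        exact ⟨w, ⟨hw, hu ▸ mem_univ _⟩, rfl⟩
      rw [this]
      exact isClosed_univ

theorem isClosed_image_of_isLowerSet (hR : IsStripReeb c a π g) (hc : Continuous c) {C : Set ℝ}
    (hC : IsClosed C) (hC' : IsLowerSet C) : IsClosed (π '' {w | w ∈ strip c a ∧ w.2 ∈ C}) := by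
  convert hR.reflect_snd.isClosed_image_of_isUpperSet (hc.comp continuous_neg)
    (hC.preimage continuous_neg) (fun t u htu ht => hC' (neg_le_neg htu) ht) using 1
  ext q
  constructor
  · rintro ⟨w, ⟨hw, hx⟩, rfl⟩
    exact ⟨(w.1, -w.2), ⟨by simpa [strip] using hw, by simpa using hx⟩, by simp⟩
  · rintro ⟨w, ⟨hw, hx⟩, rfl⟩
    exact ⟨(w.1, -w.2), ⟨by simpa [strip] using hw, by simpa using hx⟩, by simp⟩

/-- Once a path from `s` has left the star it never returns, so the part of the complement above `s`
is a closed upper set and the part below is a closed lower set; the contours meeting either part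
form a closed set. -/
theorem isOpen_starNhd (hR : IsStripReeb c a π g) (h : IsTame c S a) (s : ℝ) :
    IsOpen (starNhd c S a π s) := by
  have hmono : ∀ t u, t ∉ star c S s → t ∈ uIcc s u → u ∉ star c S s := fun t u ht htu hu =>
    ht fun r hr => hu r (uIcc_subset_uIcc left_mem_uIcc htu hr)
  have h1 := hR.isClosed_image_of_isUpperSet h.cont
    ((isClosed_Ici (a := s)).inter (h.isOpen_star s).isClosed_compl)
    fun t u htu ht => ⟨ht.1.trans htu, hmono t u ht.2 (mem_uIcc_of_le ht.1 htu)⟩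
  have h2 := hR.isClosed_image_of_isLowerSet h.cont
    ((isClosed_Iic (a := s)).inter (h.isOpen_star s).isClosed_compl)
    fun t u htu ht => ⟨htu.trans ht.1, hmono t u ht.2 (mem_uIcc_of_ge htu ht.1)⟩
  rw [← isClosed_compl_iff]
  convert h1.union h2 using 1
  ext q
  simp only [starNhd, mem_compl_iff, mem_ofPred_eq, not_forall, mem_union, mem_image, mem_inter_iff,
    mem_Ici, mem_Iic]
  constructor
  · rintro ⟨w, hw, he, hs⟩
    rcases le_total s w.2 with hle | hle
    · exact Or.inl ⟨w, ⟨hw, hle, hs⟩, he⟩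
    · exact Or.inr ⟨w, ⟨hw, hle, hs⟩, he⟩
  · rintro (⟨w, ⟨hw, -, hs⟩, he⟩ | ⟨w, ⟨hw, -, hs⟩, he⟩)
    · exact ⟨w, hw, he, hs⟩
    · exact ⟨w, hw, he, hs⟩

theorem mem_starNhd_of_mem (hR : IsStripReeb c a π g) (h : IsTame c S a) {p s : ℝ} (hs : s ∈ S)
    (hw : (p, s) ∈ strip c a) : π (p, s) ∈ starNhd c S a π s := by
  intro w hw' he r hr hrS
  obtain ⟨-, h2⟩ := (hR.eq_iff _ hw _ hw').1 he.symm
  exact (h.eq_of_level (p := p) hs hrS fun u hu =>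
    h2 u (uIcc_subset_uIcc left_mem_uIcc hr hu)).symm

/-- If the contour passes over a point of `S`, that point serves. Otherwise the whole contour lies
over one gap, and any star containing one of its points contains them all. -/
theorem exists_mem_starNhd (hR : IsStripReeb c a π g) (h : IsTame c S a) (q : R) :
    ∃ s ∈ S, q ∈ starNhd c S a π s := by
  obtain ⟨w, hw, rfl⟩ := hR.surj q
  by_cases hs : ∃ s ∈ S, (w.1, s) ∈ strip c a ∧ π (w.1, s) = π w
  · obtain ⟨s, hs, hsw, he⟩ := hs
    exact ⟨s, hs, he ▸ hR.mem_starNhd_of_mem h hs hsw⟩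
  · obtain ⟨s, hsS, hst⟩ := h.exists_mem_star w.2
    refine ⟨s, hsS, fun w' hw' he => IsTame.mem_star_of_uIcc_disjoint hst fun r hr hrS => hs ?_⟩
    obtain ⟨h1, h2⟩ := (hR.eq_iff _ hw _ hw').1 he.symm
    exact ⟨r, hrS, h2 r hr, (hR.eq_of_uIcc fun u hu =>
      h2 u (uIcc_subset_uIcc left_mem_uIcc hr hu)).symm⟩

/-- Between `s` and `t` the values of `c` lie between `c s` and `c t`, so a level admissible at both
ends is admissible all along. -/
theorem eq_of_mem_star (hR : IsStripReeb c a π g) (h : IsTame c S a) {s t p : ℝ} (hs : s ∈ S)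
    (ht : t ∈ star c S s) (hw : (p, s) ∈ strip c a) (hw' : (p, t) ∈ strip c a) :
    π (p, s) = π (p, t) := by
  refine hR.eq_of_uIcc fun r hr => ?_
  have := h.mem_uIcc_of_mem_star hs ht hr
  simp only [strip, mem_ofPred_eq] at hw hw' ⊢
  rcases mem_uIcc.1 this with h1 | h1 <;> constructor <;> linarith

theorem coreEdge_eq (hR : IsStripReeb c a π g) (h : IsTame c S a) {s s' : ℝ} (hs : s ∈ S)
    (hs' : s' ∈ S) (hst : s' ∈ star c S s) : coreEdge c a π s' = coreEdge c a π s := by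
  have hc : c s' = c s := hst s' right_mem_uIcc hs'
  rw [coreEdge, coreEdge, hc]
  refine image_congr fun p hp => (hR.eq_of_mem_star h hs hst ⟨hp.1.le, hp.2.le⟩ ?_).symm
  exact ⟨by simp only [hc]; exact hp.1.le, by simp only [hc]; exact hp.2.le⟩

/-- Every point that is not a vertex lies in one of the open edges. -/
theorem mem_coreEdge_or_gapEdge (hR : IsStripReeb c a π g) {q : R}
    (hq : q ∉ lows c S π ∪ highs c S a π) :
    (∃ s ∈ S, q ∈ coreEdge c a π s) ∨ ∃ t, t ∉ S ∧ q ∈ gapEdge c S a π t := by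
  obtain ⟨w, hw, rfl⟩ := hR.surj q
  by_cases hs : ∃ s ∈ S, (w.1, s) ∈ strip c a ∧ π (w.1, s) = π w
  · obtain ⟨s, hs, hsw, he⟩ := hs
    refine Or.inl ⟨s, hs, w.1, ⟨lt_of_le_of_ne hsw.1 fun h1 => ?_,
      lt_of_le_of_ne hsw.2 fun h1 => ?_⟩, he⟩
    · exact hq (Or.inl ⟨s, hs, by simp only at h1 ⊢; rw [h1, he]⟩)
    · exact hq (Or.inr ⟨s, hs, by simp only at h1 ⊢; rw [← h1, he]⟩)
  · push Not at hs
    have hwS : w.2 ∉ S := fun hS => hs w.2 hS hw rfl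
    refine Or.inr ⟨w.2, hwS, w, hw, rfl, fun r hr => ?_, hs⟩
    rw [uIcc_self, mem_singleton_iff] at hr
    rwa [hr]

/-- A common contour would force `c s = c s'`, although its level is both `c s` and `c s' + a`. -/
theorem disjoint_lows_highs (hR : IsStripReeb c a π g) (h : IsTame c S a) :
    Disjoint (lows c S π) (highs c S a π) := by
  rw [Set.disjoint_left]
  rintro q ⟨s, hs, rfl⟩ ⟨s', hs', he⟩
  have ha := h.pos
  obtain ⟨h1, h2⟩ := (hR.eq_iff _ (by constructor <;> simp only <;> linarith) _
    (by constructor <;> simp only <;> linarith)).1 he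
  have := h.eq_of_level hs' hs h2
  simp only at h1
  linarith

end IsStripReeb

/-! ### Monotone edges -/

/-- An edge for the vertex set `V` on whose closure `g` is injective, with its minimum at an end
point in `L` and its maximum at an end point in `H`, if it has such end points. -/
structure IsMonotoneEdge {R : Type*} [TopologicalSpace R] (V L H : Set R) (g : R → ℝ)
    (e : Set R) : Prop where
  nonempty : e.Nonempty
  subset : e ⊆ Vᶜ
  component : ∀ x ∈ e, connectedComponentIn Vᶜ x = e
  shape : IsArcEdge V e ∨ IsEndEdge V e
  injOn : InjOn g (closure e)
  -- The frequency clauses exhibit, arbitrarily close to `v`, values of `g` strictly on one side of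
  -- `g v`; they are what excludes local extrema later.
  endpoint : ∀ v ∈ V, v ∈ closure e →
    (v ∈ L ∧ IsMinOn g (closure e) v ∧ ∃ᶠ q in 𝓝 v, g v < g q) ∨
    (v ∈ H ∧ IsMaxOn g (closure e) v ∧ ∃ᶠ q in 𝓝 v, g q < g v)

namespace IsMonotoneEdge

variable {R : Type*} [TopologicalSpace R] {V L H : Set R} {g : R → ℝ} {e : Set R}

theorem of_neg (h : IsMonotoneEdge V H L (fun q => -g q) e) : IsMonotoneEdge V L H g e where
  nonempty := h.nonempty
  subset := h.subset
  component := h.component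
  shape := h.shape
  injOn x hx y hy hxy := h.injOn hx hy (by simp [hxy])
  endpoint v hv hve := by
    rcases h.endpoint v hv hve with ⟨h1, h2, h3⟩ | ⟨h1, h2, h3⟩
    · refine Or.inr ⟨h1, fun x hx => ?_, h3.mono fun q hq => by simpa using hq⟩
      have := h2 hx
      simpa using this
    · refine Or.inl ⟨h1, fun x hx => ?_, h3.mono fun q hq => by simpa using hq⟩
      have := h2 hx
      simpa using this

theorem mem_edges (h : IsMonotoneEdge V L H g e) : e ∈ edges V := by
  obtain ⟨x, hx⟩ := h.nonempty
  exact ⟨x, h.subset hx, (h.component x hx).symm⟩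

theorem isPreconnected_image_of_ordConnected {J I : Set ℝ} {γ : ℝ → R} (hI : I.OrdConnected) (hIJ : I ⊆ J)
    (hγ : ContinuousOn γ J) : IsPreconnected (γ '' I) :=
  hI.isPreconnected.image _ (hγ.mono hIJ)

/-- A parametrized curve along which `g` is strictly increasing is an embedding. -/
theorem exists_homeomorph {J : Set ℝ} {γ : ℝ → R} (hg : Continuous g) (hJ : J.OrdConnected)
    (hγ : ContinuousOn γ J) (hmono : StrictMonoOn (fun t => g (γ t)) J) :
    ∃ φ : J ≃ₜ (γ '' J : Set R), ∀ t, (φ t : R) = γ t := by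
  have hc : Continuous (fun t : J => γ t) := continuousOn_iff_continuous_domRestrict.1 hγ
  have hs : StrictMono (fun t : J => g (γ t)) := fun x y hxy => hmono x.2 y.2 hxy
  have : PreconnectedSpace J := isPreconnected_iff_preconnectedSpace.1 hJ.isPreconnected
  have ho : (range (fun t : J => g (γ t))).OrdConnected :=
    (isPreconnected_range (hg.comp hc)).ordConnected
  have : J.OrdConnected := hJ
  have he : IsEmbedding (fun t : J => g (γ t)) := hs.isEmbedding_of_ordConnected ho
  -- The composite with `g` is an embedding into the line, hence so is the curve itself.
  have he' : IsEmbedding (fun t : J => γ t) := IsEmbedding.of_comp hc hg he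
  refine ⟨he'.toHomeomorph.trans (Homeomorph.setCongr ?_), fun t => rfl⟩
  ext q
  simp [mem_image]

/-- The curve over `I` is open, the curve over `J` is closed, and they differ only by vertices. So
the curve over `I` is connected and clopen in the complement of `V`, hence a component of it. -/
theorem of_section {J I : Set ℝ} {γ : ℝ → R} (hI : I.OrdConnected)
    (hIne : I.Nonempty) (hcl : closure I = J) (hγ : ContinuousOn γ J)
    (hmono : StrictMonoOn (fun t => g (γ t)) J) (hclosed : IsClosed (γ '' J))
    (hopen : IsOpen (γ '' I)) (hV : ∀ t ∈ J, γ t ∈ V ↔ t ∉ I)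
    (hend : ∀ t ∈ J, t ∉ I → (γ t ∈ L ∧ ∀ u ∈ J, t ≤ u) ∨ (γ t ∈ H ∧ ∀ u ∈ J, u ≤ t))
    (hshape : (closure (γ '' I) = γ '' J) → IsArcEdge V (γ '' I) ∨ IsEndEdge V (γ '' I)) :
    IsMonotoneEdge V L H g (γ '' I) := by
  have hIJ : I ⊆ J := hcl ▸ subset_closure
  have hcle : closure (γ '' I) = γ '' J := by
    refine Subset.antisymm (closure_minimal (image_mono hIJ) hclosed) ?_
    rw [← hcl] at hγ ⊢
    exact hγ.image_closure
  have hsub : γ '' I ⊆ Vᶜ := by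
    rintro _ ⟨t, ht, rfl⟩ hv
    exact (hV t (hIJ ht)).1 hv ht
  have hfreq : ∀ v ∈ V, v ∈ closure (γ '' I) → ∀ P : R → Prop, (∀ u ∈ I, P (γ u)) →
      ∃ᶠ q in 𝓝 v, P q := by
    intro v _ hve P hP
    exact (mem_closure_iff_frequently.1 hve).mono fun q ⟨u, hu, he⟩ => he ▸ hP u hu
  refine ⟨hIne.image _, hsub, fun x hx => ?_, hshape hcle, ?_, fun v hv hve => ?_⟩
  · refine Subset.antisymm ?_
      ((isPreconnected_image_of_ordConnected hI hIJ hγ).subset_connectedComponentIn hx hsub)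
    refine isPreconnected_connectedComponentIn.subset_left_of_subset_union hopen
      hclosed.isOpen_compl ?_ ?_ ⟨x, mem_connectedComponentIn (hsub hx), hx⟩
    · rw [disjoint_compl_right_iff_subset]
      exact image_mono hIJ
    · intro y hy
      by_cases hyJ : y ∈ γ '' J
      · obtain ⟨t, ht, rfl⟩ := hyJ
        left
        refine ⟨t, ?_, rfl⟩
        by_contra htI
        exact connectedComponentIn_subset _ _ hy ((hV t ht).2 htI)
      · exact Or.inr hyJ
  · rw [hcle]
    rintro _ ⟨t, ht, rfl⟩ _ ⟨u, hu, rfl⟩ h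
    rw [hmono.injOn ht hu h]
  · obtain ⟨t, ht, rfl⟩ := hcle ▸ hve
    have htI := (hV t ht).1 hv
    rcases hend t ht htI with ⟨h1, h2⟩ | ⟨h1, h2⟩
    · refine Or.inl ⟨h1, ?_, hfreq _ hv hve _ fun u hu => ?_⟩
      · rw [hcle]
        rintro _ ⟨u, hu, rfl⟩
        exact hmono.monotoneOn ht hu (h2 u hu)
      · exact hmono ht (hIJ hu) (lt_of_le_of_ne (h2 u (hIJ hu)) fun h => htI (h ▸ hu))
    · refine Or.inr ⟨h1, ?_, hfreq _ hv hve _ fun u hu => ?_⟩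
      · rw [hcle]
        rintro _ ⟨u, hu, rfl⟩
        exact hmono.monotoneOn hu ht (h2 u hu)
      · exact hmono (hIJ hu) ht (lt_of_le_of_ne (h2 u (hIJ hu)) fun h => htI (h ▸ hu))

theorem of_arc {x y : ℝ} (hxy : x < y) {γ : ℝ → R} (hg : Continuous g)
    (hγ : ContinuousOn γ (Icc x y)) (hmono : StrictMonoOn (fun t => g (γ t)) (Icc x y))
    (hclosed : IsClosed (γ '' Icc x y)) (hopen : IsOpen (γ '' Ioo x y))
    (hV : ∀ t ∈ Ioo x y, γ t ∉ V) (hx : γ x ∈ V ∩ L) (hy : γ y ∈ V ∩ H) :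
    IsMonotoneEdge V L H g (γ '' Ioo x y) := by
  have hends : ∀ t ∈ Icc x y, t ∉ Ioo x y → t = x ∨ t = y := by
    intro t ht ht'
    by_contra! hcon
    exact ht' ⟨lt_of_le_of_ne ht.1 hcon.1.symm, lt_of_le_of_ne ht.2 hcon.2⟩
  have hV' : ∀ t ∈ Icc x y, γ t ∈ V ↔ t ∉ Ioo x y := by
    refine fun t ht => ⟨fun h1 h2 => hV t h2 h1, fun h => ?_⟩
    rcases hends t ht h with rfl | rfl
    · exact hx.1
    · exact hy.1
  refine of_section ordConnected_Ioo (nonempty_Ioo.2 hxy) (closure_Ioo hxy.ne) hγ hmono hclosed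
    hopen hV' (fun t ht ht' => ?_) fun hcle => Or.inl ?_
  · rcases hends t ht ht' with rfl | rfl
    · exact Or.inl ⟨hx.2, fun u hu => hu.1⟩
    · exact Or.inr ⟨hy.2, fun u hu => hu.2⟩
  · obtain ⟨φ, hφ⟩ := exists_homeomorph hg ordConnected_Icc hγ hmono
    refine ⟨((iccHomeoI x y hxy).symm.trans φ).trans (Homeomorph.setCongr hcle.symm),
      fun t => ?_⟩
    have h1 : ((((iccHomeoI x y hxy).symm.trans φ).trans (Homeomorph.setCongr hcle.symm)) t : R) =
        γ ((iccHomeoI x y hxy).symm t) := hφ _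
    rw [h1, hV' _ ((iccHomeoI x y hxy).symm t).2, iccHomeoI_symm_apply_coe]
    have h01 := t.2
    have hpos : 0 < y - x := sub_pos.2 hxy
    constructor
    · intro h
      by_contra! hcon
      have h0 : 0 < (t : ℝ) := lt_of_le_of_ne h01.1 hcon.1.symm
      have h1 : (t : ℝ) < 1 := lt_of_le_of_ne h01.2 hcon.2
      exact h ⟨by nlinarith, by nlinarith⟩
    · rintro (h | h) ⟨h2, h3⟩ <;> rw [h] at h2 h3 <;> linarith

theorem of_ray {x : ℝ} {γ : ℝ → R} (hg : Continuous g)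
    (hγ : ContinuousOn γ (Ici x)) (hmono : StrictMonoOn (fun t => g (γ t)) (Ici x))
    (hclosed : IsClosed (γ '' Ici x)) (hopen : IsOpen (γ '' Ioi x))
    (hV : ∀ t ∈ Ioi x, γ t ∉ V) (hx : γ x ∈ V ∩ L) :
    IsMonotoneEdge V L H g (γ '' Ioi x) := by
  have hV' : ∀ t ∈ Ici x, γ t ∈ V ↔ t ∉ Ioi x := by
    refine fun t ht => ⟨fun h1 h2 => hV t h2 h1, fun h => ?_⟩
    rw [mem_Ioi, not_lt] at h
    rw [le_antisymm h ht]
    exact hx.1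
  refine of_section ordConnected_Ioi nonempty_Ioi (closure_Ioi x) hγ hmono hclosed
    hopen hV' (fun t ht ht' => ?_) fun hcle => Or.inr ?_
  · rw [mem_Ioi, not_lt] at ht'
    rw [le_antisymm ht' ht]
    exact Or.inl ⟨hx.2, fun u hu => hu⟩
  · obtain ⟨φ, hφ⟩ := exists_homeomorph hg ordConnected_Ici hγ hmono
    have hsh : ∀ t : ℝ, t ∈ Ici (0 : ℝ) ↔ Homeomorph.addRight x t ∈ Ici x := fun t => by simp
    refine ⟨(((Homeomorph.addRight x).subtype hsh).trans φ).trans (Homeomorph.setCongr hcle.symm),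
      fun t => ?_⟩
    have h1 : (((((Homeomorph.addRight x).subtype hsh).trans φ).trans
        (Homeomorph.setCongr hcle.symm)) t : R) = γ (t + x) := hφ _
    have h0 : (0 : ℝ) ≤ t := t.2
    rw [h1, hV' _ (by simpa using h0), mem_Ioi, not_lt]
    constructor
    · intro h; linarith
    · intro h; linarith

theorem locallyCompactSpace (h : IsMonotoneEdge V L H g e) : LocallyCompactSpace (closure e) := by
  rcases h.shape with ⟨γ, -⟩ | ⟨γ, -⟩
  · exact γ.symm.isClosedEmbedding.locallyCompactSpace
  · have : LocallyCompactSpace (Ici (0 : ℝ)) := isClosed_Ici.isClosedEmbedding_subtypeVal.locallyCompactSpace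
    exact γ.symm.isClosedEmbedding.locallyCompactSpace

end IsMonotoneEdge

/-- Only finitely many of the closed pieces contain `x`; the union of compact neighbourhoods of `x`
in each of them is a compact neighbourhood in the whole space. -/
theorem locallyCompactSpace_of_locallyFinite {R ι : Type*} [TopologicalSpace R] [T2Space R]
    {f : ι → Set R} (hf : LocallyFinite f) (hclosed : ∀ i, IsClosed (f i))
    (hcover : ⋃ i, f i = univ) (hloc : ∀ i, LocallyCompactSpace (f i)) :
    LocallyCompactSpace R := by
  have : WeaklyLocallyCompactSpace R := by
    refine ⟨fun x => ?_⟩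
    have hK : ∀ i, ∃ K : Set R, IsCompact K ∧ (x ∈ f i → K ∈ 𝓝[f i] x) := by
      intro i
      by_cases hx : x ∈ f i
      · obtain ⟨K, hK, hKx⟩ := exists_compact_mem_nhds (⟨x, hx⟩ : f i)
        refine ⟨Subtype.val '' K, hK.image continuous_subtype_val, fun _ => ?_⟩
        rw [← map_nhds_subtype_val ⟨x, hx⟩]
        exact Filter.image_mem_map hKx
      · exact ⟨∅, isCompact_empty, fun h => absurd h hx⟩
    choose K hK hKx using hK
    refine ⟨⋃ i ∈ {i | x ∈ f i}, K i, (hf.point_finite x).isCompact_biUnion fun i _ => hK i, ?_⟩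
    rw [← nhdsWithin_univ, ← hcover, hf.nhdsWithin_iUnion, Filter.mem_iSup]
    intro i
    by_cases hx : x ∈ f i
    · exact Filter.mem_of_superset (hKx i hx) (subset_biUnion_of_mem (u := K) hx)
    · have : 𝓝[f i] x = ⊥ := by
        rw [← Filter.not_neBot, ← mem_closure_iff_nhdsWithin_neBot, (hclosed i).closure_eq]
        exact hx
      rw [this]
      exact Filter.mem_bot
  infer_instance

/-! ### Vertices and gap edges under reflections -/

section Reflections

variable {R : Type*} {c : ℝ → ℝ} {S : Set ℝ} {a : ℝ} {π : ℝ × ℝ → R}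

theorem lows_reflect_snd :
    lows (fun t => c (-t)) {t | -t ∈ S} (fun w => π (w.1, -w.2)) = lows c S π := by
  ext q
  constructor
  · rintro ⟨s, hs, rfl⟩
    exact ⟨-s, hs, rfl⟩
  · rintro ⟨s, hs, rfl⟩
    exact ⟨-s, by simpa using hs, by simp⟩

theorem highs_reflect_snd :
    highs (fun t => c (-t)) {t | -t ∈ S} a (fun w => π (w.1, -w.2)) = highs c S a π := by
  ext q
  constructor
  · rintro ⟨s, hs, rfl⟩
    exact ⟨-s, hs, rfl⟩
  · rintro ⟨s, hs, rfl⟩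
    exact ⟨-s, by simpa using hs, by simp⟩

theorem gapEdge_reflect_snd (t : ℝ) :
    gapEdge (fun t => c (-t)) {t | -t ∈ S} a (fun w => π (w.1, -w.2)) (-t) =
      gapEdge c S a π t := by
  have hn : ∀ u r : ℝ, r ∈ uIcc (-t) (-u) ↔ -r ∈ uIcc t u := by
    intro u r
    simp only [mem_uIcc]
    constructor <;> rintro (hr | hr)
    · right; constructor <;> linarith
    · left; constructor <;> linarith
    · right; constructor <;> linarith
    · left; constructor <;> linarith
  ext q
  constructor
  · rintro ⟨w, hw, he, hd, hS⟩
    refine ⟨(w.1, -w.2), hw, he, fun r hr hrS => hd (-r) ?_ (by simpa using hrS),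
      fun s hs hsw hse => hS (-s) (by simpa using hs) (by simpa [strip] using hsw)
        (by simpa using hse)⟩
    have := (hn (-w.2) (-r)).2 (by simpa using hr)
    simpa using this
  · rintro ⟨w, hw, he, hd, hS⟩
    refine ⟨(w.1, -w.2), by simpa [strip] using hw, by simpa using he,
      fun r hr hrS => hd (-r) ((hn _ _).1 hr) hrS,
      fun s hs hsw hse => hS (-s) hs hsw hse⟩

theorem lows_reflect_fst :
    lows (fun t => -c t - a) S (fun w => π (-w.1, w.2)) = highs c S a π := by
  refine image_congr fun s _ => ?_
  simp only
  congr 2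
  ring

theorem highs_reflect_fst :
    highs (fun t => -c t - a) S a (fun w => π (-w.1, w.2)) = lows c S π := by
  refine image_congr fun s _ => ?_
  simp only
  congr 2
  ring

theorem gapEdge_reflect_fst (t : ℝ) :
    gapEdge (fun t => -c t - a) S a (fun w => π (-w.1, w.2)) t = gapEdge c S a π t := by
  ext q
  constructor
  · rintro ⟨w, hw, he, hd, hS⟩
    refine ⟨(-w.1, w.2), IsStripReeb.mem_strip_neg.1 hw, he, hd,
      fun s hs hsw => hS s hs (IsStripReeb.mem_strip_neg.2 hsw)⟩
  · rintro ⟨w, hw, he, hd, hS⟩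
    refine ⟨(-w.1, w.2), IsStripReeb.mem_strip_neg.2 (by simpa using hw), by simpa using he, hd,
      fun s hs hsw => ?_⟩
    have := hS s hs (by simpa using IsStripReeb.mem_strip_neg.1 hsw)
    simpa using this

end Reflections

/-! ### Core edges and gap edges are monotone -/

namespace IsStripReeb

variable {R : Type*} [TopologicalSpace R] {c : ℝ → ℝ} {S : Set ℝ} {a : ℝ} {π : ℝ × ℝ → R}
  {g : R → ℝ}

theorem eq_iff_mk (hR : IsStripReeb c a π g) {p t p' t' : ℝ} (hw : (p, t) ∈ strip c a)
    (hw' : (p', t') ∈ strip c a) :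
    π (p, t) = π (p', t') ↔ p = p' ∧ ∀ r ∈ uIcc t t', (p, r) ∈ strip c a :=
  hR.eq_iff _ hw _ hw'

theorem low_mem (ha : 0 ≤ a) (s : ℝ) : (c s, s) ∈ strip c a := ⟨le_rfl, by simpa using ha⟩

theorem high_mem (ha : 0 ≤ a) (s : ℝ) : (c s + a, s) ∈ strip c a := ⟨by simpa using ha, le_rfl⟩

/-- A contour through a point over `S` that is a vertex lies at the boundary of the strip. -/
theorem eq_of_mem_vertices (hR : IsStripReeb c a π g) (h : IsTame c S a) {p s : ℝ} (hs : s ∈ S)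
    (hw : (p, s) ∈ strip c a) (hv : π (p, s) ∈ lows c S π ∪ highs c S a π) :
    p = c s ∨ p = c s + a := by
  rcases hv with ⟨s', hs', he⟩ | ⟨s', hs', he⟩
  · obtain ⟨h1, h2⟩ := (hR.eq_iff_mk hw (low_mem h.pos.le s')).1 he.symm
    left
    rw [h1, h.eq_of_level hs hs' h2]
  · obtain ⟨h1, h2⟩ := (hR.eq_iff_mk hw (high_mem h.pos.le s')).1 he.symm
    right
    rw [h1, h.eq_of_level hs hs' h2]

theorem isMonotoneEdge_coreEdge (hR : IsStripReeb c a π g) (h : IsTame c S a) {s : ℝ}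
    (hs : s ∈ S) : IsMonotoneEdge (lows c S π ∪ highs c S a π) (lows c S π) (highs c S a π) g
      (coreEdge c a π s) := by
  have ha := h.pos
  have := hR.t2Space h.cont
  have hγ : ContinuousOn (fun p => π (p, s)) (Icc (c s) (c s + a)) :=
    hR.contOn.comp (by fun_prop) fun p hp => hp
  have hval : ∀ p ∈ Icc (c s) (c s + a), g (π (p, s)) = p := fun p hp => hR.val (p, s) hp
  refine IsMonotoneEdge.of_arc (by linarith) hR.continuous_val hγ ?_
    (isCompact_Icc.image_of_continuousOn hγ).isClosed ?_ ?_ ⟨Or.inl ⟨s, hs, rfl⟩, s, hs, rfl⟩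
    ⟨Or.inr ⟨s, hs, rfl⟩, s, hs, rfl⟩
  · intro p hp p' hp' hlt
    simpa only [hval p hp, hval p' hp'] using hlt
  -- At the levels of the core edge, a point of the strip has its contour pass over `s` exactly when
  -- it lies over the star of `s`.
  · refine hR.isOpen _ (Ioo (c s) (c s + a) ×ˢ star c S s) (isOpen_Ioo.prod (h.isOpen_star s))
      fun w hw => ?_
    constructor
    · rintro ⟨p, hp, he⟩
      obtain ⟨h1, -⟩ := (hR.eq_iff_mk ⟨hp.1.le, hp.2.le⟩ hw).1 he
      refine ⟨by rwa [← h1], ?_⟩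
      exact hR.mem_starNhd_of_mem h hs ⟨hp.1.le, hp.2.le⟩ w hw he.symm
    · rintro ⟨h1, h2⟩
      exact ⟨w.1, h1, hR.eq_of_mem_star h hs h2 ⟨h1.1.le, h1.2.le⟩ hw⟩
  · intro p hp hv
    rcases hR.eq_of_mem_vertices h hs ⟨hp.1.le, hp.2.le⟩ hv with h1 | h1
    · exact hp.1.ne' h1
    · exact hp.2.ne h1

/-- The gap edge as the set of contours over the gap in a range of levels. -/
theorem mem_gapEdge_iff (hR : IsStripReeb c a π g) {t : ℝ} {w : ℝ × ℝ} (hw : w ∈ strip c a) :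
    π w ∈ gapEdge c S a π t ↔ (∀ r ∈ uIcc t w.2, r ∉ S) ∧
      ∀ s ∈ S, (w.1, s) ∈ strip c a → π (w.1, s) ≠ π w := by
  refine ⟨?_, fun h => ⟨w, hw, rfl, h⟩⟩
  rintro ⟨w', hw', he, hd, hS⟩
  obtain ⟨h1, h2⟩ := (hR.eq_iff w' hw' w hw).1 he
  refine ⟨fun r hr hrS => ?_, fun s hs hsw hse => hS s hs ?_ ?_⟩
  · rcases uIcc_subset_uIcc_union_uIcc (b := w'.2) hr with h3 | h3
    · exact hd r h3 hrS
    · refine hS r hrS (h2 r h3) ?_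
      rw [← he]
      exact (hR.eq_of_uIcc fun u hu => h2 u (uIcc_subset_uIcc left_mem_uIcc h3 hu)).symm
  · rwa [h1]
  · rw [h1, hse]

theorem gapEdge_subset_compl (hR : IsStripReeb c a π g) (ha : 0 ≤ a) (t : ℝ) :
    gapEdge c S a π t ⊆ (lows c S π ∪ highs c S a π)ᶜ := by
  rintro q ⟨w, hw, he, -, hS⟩ hv
  rcases hv with ⟨s, hs, hse⟩ | ⟨s, hs, hse⟩
  · obtain ⟨h1, -⟩ := (hR.eq_iff_mk (low_mem ha s) hw).1 (hse.trans he.symm)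
    exact hS s hs (h1 ▸ low_mem ha s) (by rw [← h1]; exact hse)
  · obtain ⟨h1, -⟩ := (hR.eq_iff_mk (high_mem ha s) hw).1 (hse.trans he.symm)
    exact hS s hs (h1 ▸ high_mem ha s) (by rw [← h1]; exact hse)

/-- When `c` increases from `x` to `y`, each contour at a level in `[c x + a, c y]` over the gap
starts at one point of the upper boundary, which parametrizes it. The parameter runs up to the point
`z` with `c z + a = c y`, whose contour reaches the low vertex at `y`. -/
theorem isMonotoneEdge_gapEdge_arc (hR : IsStripReeb c a π g) (h : IsTame c S a) {x y t₀ : ℝ}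
    (hx : x ∈ S) (hy : y ∈ S) (ht₀ : t₀ ∈ Ioo x y) (hd : ∀ t ∈ Ioo x y, t ∉ S)
    (hmono : StrictMonoOn c (Icc x y)) :
    IsMonotoneEdge (lows c S π ∪ highs c S a π) (highs c S a π) (lows c S π) g
      (gapEdge c S a π t₀) := by
  have ha := h.pos
  have := hR.t2Space h.cont
  have hxy : x < y := ht₀.1.trans ht₀.2
  have hcxy : c x < c y := hmono ⟨le_rfl, hxy.le⟩ ⟨hxy.le, le_rfl⟩ hxy
  have hgap : c x < c y - a := by
    have := h.gap x y hxy hx hy hd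
    rw [abs_sub_comm, abs_of_pos (by linarith)] at this
    linarith
  -- The gap condition `c x + a < c y` is what places `z` strictly to the right of `x`.
  obtain ⟨z, hz, hcz⟩ := intermediate_value_Icc hxy.le h.cont.continuousOn
    (show c y - a ∈ Icc (c x) (c y) from ⟨hgap.le, by linarith⟩)
  have hxz : x < z := lt_of_le_of_ne hz.1 fun e => by rw [← e] at hcz; linarith
  have hzy : z < y := lt_of_le_of_ne hz.2 fun e => by rw [e] at hcz; linarith
  have hsub : Icc x z ⊆ Icc x y := Icc_subset_Icc_right hz.2
  have hγ : ContinuousOn (fun t => π (c t + a, t)) (Icc x z) :=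
    hR.contOn.comp (Continuous.continuousOn (by have := h.cont; fun_prop))
      fun t _ => high_mem ha.le t
  have hval : ∀ t, g (π (c t + a, t)) = c t + a := fun t => hR.val _ (high_mem ha.le t)
  have hyz : π (c z + a, z) = π (c y, y) := by
    have he : c z + a = c y := by linarith
    rw [he]
    refine hR.eq_of_uIcc fun r hr => ?_
    rw [uIcc_of_le hz.2] at hr
    have h1 := hmono.monotoneOn hz ⟨hz.1.trans hr.1, hr.2⟩ hr.1
    have h2 := hmono.monotoneOn ⟨hz.1.trans hr.1, hr.2⟩ ⟨hxy.le, le_rfl⟩ hr.2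
    exact ⟨h2, by simp only; linarith⟩
  have hchar : ∀ w ∈ strip c a, π w ∈ (fun t => π (c t + a, t)) '' Ioo x z ↔
      w ∈ Ioo (c x + a) (c y) ×ˢ Ioo x y := by
    intro w hw
    constructor
    · rintro ⟨t, ht, he⟩
      obtain ⟨h1, h2⟩ := (hR.eq_iff_mk (high_mem ha.le t) hw).1 he
      have h3 := hmono ⟨le_rfl, hxy.le⟩ (hsub ⟨ht.1.le, ht.2.le⟩) ht.1
      have h4 := hmono (hsub ⟨ht.1.le, ht.2.le⟩) hz ht.2
      refine ⟨⟨by linarith, by linarith⟩, ?_, ?_⟩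
      · by_contra! hcon
        have := (h2 x (mem_uIcc_of_ge hcon ht.1.le)).2
        simp only at this
        linarith
      · by_contra! hcon
        have := (h2 y (mem_uIcc_of_le (ht.2.trans hzy).le hcon)).1
        simp only at this
        linarith
    · rintro ⟨⟨h1, h2⟩, h3⟩
      obtain ⟨t, ht, hct⟩ := intermediate_value_Icc h3.1.le h.cont.continuousOn
        (show w.1 - a ∈ Icc (c x) (c w.2) from ⟨by linarith, by linarith [hw.2]⟩)
      have hxt : x < t := lt_of_le_of_ne ht.1 fun e => by rw [← e] at hct; linarith
      have ht' : t ∈ Icc x y := ⟨ht.1, ht.2.trans h3.2.le⟩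
      refine ⟨t, ⟨hxt, (hmono.lt_iff_lt ht' hz).1 (by linarith)⟩, ?_⟩
      have he : c t + a = w.1 := by linarith
      simp only [he]
      refine hR.eq_of_uIcc fun r hr => ?_
      rw [uIcc_of_le ht.2] at hr
      have hr' : r ∈ Icc x y := ⟨ht.1.trans hr.1, hr.2.trans h3.2.le⟩
      have h4 := hmono.monotoneOn ht' hr' hr.1
      have h5 := hmono.monotoneOn hr' ⟨h3.1.le, h3.2.le⟩ hr.2
      exact ⟨by simp only; linarith [hw.1], by simp only; linarith⟩
  have heq : gapEdge c S a π t₀ = (fun t => π (c t + a, t)) '' Ioo x z := by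
    ext q
    obtain ⟨w, hw, rfl⟩ := hR.surj q
    rw [hchar w hw, hR.mem_gapEdge_iff hw]
    constructor
    · rintro ⟨h1, h2⟩
      have hwx : x < w.2 := by
        by_contra! hcon
        exact h1 x (mem_uIcc_of_ge hcon ht₀.1.le) hx
      have hwy : w.2 < y := by
        by_contra! hcon
        exact h1 y (mem_uIcc_of_le ht₀.2.le hcon) hy
      refine ⟨⟨?_, ?_⟩, hwx, hwy⟩
      -- At a level of at most `c x + a` the contour would extend left to `x`; the next case extends
      -- it right to `y` at a level of at least `c y`.
      · by_contra! hcon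
        have key : ∀ r ∈ uIcc x w.2, (w.1, r) ∈ strip c a := by
          intro r hr
          rw [uIcc_of_le hwx.le] at hr
          have hr' : r ∈ Icc x y := ⟨hr.1, hr.2.trans hwy.le⟩
          have h4 := hmono.monotoneOn ⟨le_rfl, hxy.le⟩ hr' hr.1
          have h5 := hmono.monotoneOn hr' ⟨hwx.le, hwy.le⟩ hr.2
          exact ⟨by simp only; linarith [hw.1], by simp only; linarith⟩
        exact h2 x hx (key x left_mem_uIcc) (hR.eq_of_uIcc key)
      · by_contra! hcon
        have key : ∀ r ∈ uIcc y w.2, (w.1, r) ∈ strip c a := by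
          intro r hr
          rw [uIcc_of_ge hwy.le] at hr
          have hr' : r ∈ Icc x y := ⟨hwx.le.trans hr.1, hr.2⟩
          have h4 := hmono.monotoneOn ⟨hwx.le, hwy.le⟩ hr' hr.1
          have h5 := hmono.monotoneOn hr' ⟨hxy.le, le_rfl⟩ hr.2
          exact ⟨by simp only; linarith, by simp only; linarith [hw.2]⟩
        exact h2 y hy (key y left_mem_uIcc) (hR.eq_of_uIcc key)
    · rintro ⟨⟨h1, h2⟩, h3⟩
      refine ⟨fun r hr => hd r (ordConnected_Ioo.uIcc_subset ht₀ h3 hr), fun s hs hsw hse => ?_⟩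
      obtain ⟨-, h4⟩ := (hR.eq_iff_mk hsw hw).1 hse
      rcases le_or_gt s x with hsx | hsx
      · have := (h4 x (mem_uIcc_of_le hsx h3.1.le)).2
        simp only at this
        linarith
      · rcases le_or_gt y s with hsy | hsy
        · have := (h4 y (mem_uIcc_of_ge h3.2.le hsy)).1
          simp only at this
          linarith
        · exact hd s ⟨hsx, hsy⟩ hs
  rw [heq]
  refine IsMonotoneEdge.of_arc hxz hR.continuous_val hγ ?_
    (isCompact_Icc.image_of_continuousOn hγ).isClosed
    (hR.isOpen _ _ (isOpen_Ioo.prod isOpen_Ioo) hchar) ?_ ⟨Or.inr ⟨x, hx, rfl⟩, x, hx, rfl⟩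
    ⟨Or.inl ⟨y, hy, hyz.symm⟩, y, hy, hyz.symm⟩
  · intro t ht u hu htu
    have := hmono (hsub ht) (hsub hu) htu
    simp only [hval]
    linarith
  · intro t ht hv
    exact hR.gapEdge_subset_compl ha.le t₀ (heq ▸ ⟨t, ht, rfl⟩) hv

/-- The upper boundary again parametrizes the edge, now without a second end point: even if `c` is
bounded at infinity, no contour in the strip is a limit of the far end. -/
theorem isMonotoneEdge_gapEdge_ray (hR : IsStripReeb c a π g) (h : IsTame c S a) {x t₀ : ℝ}
    (hx : x ∈ S) (ht₀ : x < t₀) (hd : ∀ t ∈ Ioi x, t ∉ S) (hmono : StrictMonoOn c (Ici x)) :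
    IsMonotoneEdge (lows c S π ∪ highs c S a π) (highs c S a π) (lows c S π) g
      (gapEdge c S a π t₀) := by
  have ha := h.pos
  have := hR.t2Space h.cont
  have hγ : ContinuousOn (fun t => π (c t + a, t)) (Ici x) :=
    hR.contOn.comp (Continuous.continuousOn (by have := h.cont; fun_prop))
      fun t _ => high_mem ha.le t
  have hval : ∀ t, g (π (c t + a, t)) = c t + a := fun t => hR.val _ (high_mem ha.le t)
  have hlift : ∀ w ∈ strip c a, x ≤ w.2 → c x + a ≤ w.1 →
      ∃ t ∈ Icc x w.2, c t + a = w.1 ∧ π (c t + a, t) = π w := by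
    intro w hw hxw h1
    obtain ⟨t, ht, hct⟩ := intermediate_value_Icc hxw h.cont.continuousOn
      (show w.1 - a ∈ Icc (c x) (c w.2) from ⟨by linarith, by linarith [hw.2]⟩)
    have he : c t + a = w.1 := by linarith
    refine ⟨t, ht, he, ?_⟩
    rw [he]
    refine hR.eq_of_uIcc fun r hr => ?_
    rw [uIcc_of_le ht.2] at hr
    have h4 := hmono.monotoneOn ht.1 (ht.1.trans hr.1) hr.1
    have h5 := hmono.monotoneOn (ht.1.trans hr.1) hxw hr.2
    exact ⟨by simp only; linarith [hw.1], by simp only; linarith⟩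
  have hchar : ∀ w ∈ strip c a, π w ∈ (fun t => π (c t + a, t)) '' Ioi x ↔
      w ∈ Ioi (c x + a) ×ˢ Ioi x := by
    intro w hw
    constructor
    · rintro ⟨t, ht, he⟩
      obtain ⟨h1, h2⟩ := (hR.eq_iff_mk (high_mem ha.le t) hw).1 he
      have h3 := hmono (mem_Ici.2 le_rfl) (mem_Ici.2 (le_of_lt ht)) ht
      refine ⟨mem_Ioi.2 (by linarith), ?_⟩
      by_contra hcon
      have := (h2 x (mem_uIcc_of_ge (not_lt.1 hcon) (le_of_lt ht))).2
      simp only at this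
      linarith
    · rintro ⟨h1, h3⟩
      obtain ⟨t, ht, hct, he⟩ := hlift w hw (le_of_lt h3) (le_of_lt h1)
      refine ⟨t, lt_of_le_of_ne ht.1 fun e => ?_, he⟩
      rw [← e] at hct
      exact (ne_of_gt h1) hct.symm
  have heq : gapEdge c S a π t₀ = (fun t => π (c t + a, t)) '' Ioi x := by
    ext q
    obtain ⟨w, hw, rfl⟩ := hR.surj q
    rw [hchar w hw, hR.mem_gapEdge_iff hw]
    constructor
    · rintro ⟨h1, h2⟩
      have hwx : x < w.2 := by
        by_contra! hcon
        exact h1 x (mem_uIcc_of_ge hcon ht₀.le) hx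
      refine ⟨?_, hwx⟩
      by_contra hcon
      rw [mem_Ioi, not_lt] at hcon
      have key : ∀ r ∈ uIcc x w.2, (w.1, r) ∈ strip c a := by
        intro r hr
        rw [uIcc_of_le hwx.le] at hr
        have h4 := hmono.monotoneOn (mem_Ici.2 le_rfl) hr.1 hr.1
        have h5 := hmono.monotoneOn hr.1 hwx.le hr.2
        exact ⟨by simp only; linarith [hw.1], by simp only; linarith⟩
      exact h2 x hx (key x left_mem_uIcc) (hR.eq_of_uIcc key)
    · rintro ⟨h1, h3⟩
      have hS : ∀ s ∈ S, s ≤ x := fun s hs => not_lt.1 fun hxs => hd s hxs hs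
      refine ⟨fun r hr => hd r (ordConnected_Ioi.uIcc_subset ht₀ h3 hr), fun s hs hsw hse => ?_⟩
      obtain ⟨-, h4⟩ := (hR.eq_iff_mk hsw hw).1 hse
      have := (h4 x (mem_uIcc_of_le (hS s hs) (le_of_lt h3))).2
      exact (not_lt.2 this) h1
  -- Compactness is not available for the closedness of a half-line, so its image is cut out by two
  -- closed conditions.
  have himg : (fun t => π (c t + a, t)) '' Ici x =
      π '' {w | w ∈ strip c a ∧ x ≤ w.2} ∩ g ⁻¹' Ici (c x + a) := by
    ext q
    constructor
    · rintro ⟨t, ht, rfl⟩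
      refine ⟨⟨_, ⟨high_mem ha.le t, ht⟩, rfl⟩, ?_⟩
      have := hmono.monotoneOn (mem_Ici.2 le_rfl) ht ht
      rw [mem_preimage, hval, mem_Ici]
      linarith
    · rintro ⟨⟨w, ⟨hw, hxw⟩, rfl⟩, hgw⟩
      rw [mem_preimage, hR.val w hw] at hgw
      obtain ⟨t, ht, -, he⟩ := hlift w hw hxw hgw
      exact ⟨t, ht.1, he⟩
  rw [heq]
  refine IsMonotoneEdge.of_ray hR.continuous_val hγ ?_ ?_
    (hR.isOpen _ _ (isOpen_Ioi.prod isOpen_Ioi) hchar) ?_ ⟨Or.inr ⟨x, hx, rfl⟩, x, hx, rfl⟩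
  · intro t ht u hu htu
    have := hmono ht hu htu
    simp only [hval]
    linarith
  · rw [himg]
    exact (hR.isClosed_image_ge h.cont x).inter (isClosed_Ici.preimage hR.continuous_val)
  · intro t ht hv
    exact hR.gapEdge_subset_compl ha.le t₀ (heq ▸ ⟨t, ht, rfl⟩) hv

/-- Monotonicity is assumed for every admissible interval around `t₀`, because the interval that is
needed depends on whether the gap ends on the right. -/
theorem isMonotoneEdge_gapEdge_of_strictMonoOn (hR : IsStripReeb c a π g) (h : IsTame c S a)
    {x t₀ : ℝ} (hx : x ∈ S) (ht₀ : x < t₀) (hd : ∀ t ∈ Ioc x t₀, t ∉ S)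
    (hmono : ∀ I : Set ℝ, I.OrdConnected → t₀ ∈ interior I → Disjoint (interior I) S →
      StrictMonoOn c I) :
    IsMonotoneEdge (lows c S π ∪ highs c S a π) (highs c S a π) (lows c S π) g
      (gapEdge c S a π t₀) := by
  by_cases hex : ∃ s ∈ S, t₀ ≤ s
  · obtain ⟨s, hs, hts⟩ := hex
    obtain ⟨y, hy, hty, -, hd'⟩ := exists_first_mem h.closed hs hts
    have hty' : t₀ < y := lt_of_le_of_ne hty fun e => hd t₀ ⟨ht₀, le_rfl⟩ (e ▸ hy)
    have hd2 : ∀ t ∈ Ioo x y, t ∉ S := by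
      intro t ht
      rcases le_total t t₀ with h1 | h1
      · exact hd t ⟨ht.1, h1⟩
      · exact hd' t ⟨h1, ht.2⟩
    refine hR.isMonotoneEdge_gapEdge_arc h hx hy ⟨ht₀, hty'⟩ hd2
      (hmono _ ordConnected_Icc ?_ ?_)
    · rw [interior_Icc]; exact ⟨ht₀, hty'⟩
    · rw [interior_Icc]; exact Set.disjoint_left.2 hd2
  · push Not at hex
    have hd2 : ∀ t ∈ Ioi x, t ∉ S := by
      intro t ht hS
      exact hd t ⟨ht, (hex t hS).le⟩ hS
    refine hR.isMonotoneEdge_gapEdge_ray h hx ht₀ hd2 (hmono _ ordConnected_Ici ?_ ?_)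
    · rw [interior_Ici]; exact ht₀
    · rw [interior_Ici]; exact Set.disjoint_left.2 hd2

theorem isMonotoneEdge_gapEdge_of_left (hR : IsStripReeb c a π g) (h : IsTame c S a)
    {x t₀ : ℝ} (hx : x ∈ S) (ht₀ : x < t₀) (hd : ∀ t ∈ Ioc x t₀, t ∉ S) :
    IsMonotoneEdge (lows c S π ∪ highs c S a π) (highs c S a π) (lows c S π) g
      (gapEdge c S a π t₀) := by
  have hl : Disjoint (interior (Icc x t₀)) S := by
    rw [interior_Icc, Set.disjoint_left]
    exact fun t ht => hd t ⟨ht.1, ht.2.le⟩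
  -- Such an interval shares two points with `[x, t₀]`, so `c` has the same direction of
  -- monotonicity on both.
  have hint : ∀ I : Set ℝ, t₀ ∈ interior I → ∃ u v, u < v ∧ u ∈ I ∧ v ∈ I ∧ u ∈ Icc x t₀ ∧
      v ∈ Icc x t₀ := by
    intro I hI
    obtain ⟨l, u, hlu, hsub⟩ := mem_nhds_iff_exists_Ioo_subset.1 (mem_interior_iff_mem_nhds.1 hI)
    have hm : max l x < t₀ := max_lt hlu.1 ht₀
    refine ⟨(max l x + t₀) / 2, t₀, by linarith, hsub ⟨?_, ?_⟩, interior_subset hI, ⟨?_, ?_⟩,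
      ht₀.le, le_rfl⟩
    · linarith [le_max_left l x]
    · linarith [hlu.2]
    · linarith [le_max_right l x]
    · linarith
  rcases h.mono _ ordConnected_Icc hl with hm | hm
  · refine hR.isMonotoneEdge_gapEdge_of_strictMonoOn h hx ht₀ hd fun I hI htI hIS => ?_
    rcases h.mono I hI hIS with h1 | h1
    · exact h1
    · obtain ⟨u, v, huv, hu, hv, hu', hv'⟩ := hint I htI
      exact absurd (hm hu' hv' huv) (h1 hu hv huv).not_gt
  · have key := hR.reflect_fst.isMonotoneEdge_gapEdge_of_strictMonoOn h.neg_sub hx ht₀ hd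
      fun I hI htI hIS => ?_
    · rw [lows_reflect_fst, highs_reflect_fst, gapEdge_reflect_fst, union_comm] at key
      exact key.of_neg
    · rcases h.mono I hI hIS with h1 | h1
      · obtain ⟨u, v, huv, hu, hv, hu', hv'⟩ := hint I htI
        exact absurd (hm hu' hv' huv) (h1 hu hv huv).not_gt
      · intro u hu v hv huv
        have := h1 hu hv huv
        simp only
        linarith

theorem isMonotoneEdge_gapEdge (hR : IsStripReeb c a π g) (h : IsTame c S a) {t : ℝ}
    (ht : t ∉ S) :
    IsMonotoneEdge (lows c S π ∪ highs c S a π) (highs c S a π) (lows c S π) g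
      (gapEdge c S a π t) := by
  obtain ⟨s, hs⟩ := h.nonempty
  rcases le_total s t with hst | hst
  · obtain ⟨x, hx, -, hxt, hd⟩ := exists_last_mem h.closed hs hst
    exact hR.isMonotoneEdge_gapEdge_of_left h hx (lt_of_le_of_ne hxt fun e => ht (e ▸ hx)) hd
  · obtain ⟨x, hx, htx, -, hd⟩ := exists_first_mem h.closed hs hst
    have key := hR.reflect_snd.isMonotoneEdge_gapEdge_of_left h.comp_neg (x := -x) (t₀ := -t)
      (by simpa using hx) (neg_lt_neg (lt_of_le_of_ne htx fun e => ht (e ▸ hx)))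
      fun u hu => hd (-u) ⟨by linarith [hu.2], by linarith [hu.1]⟩
    rwa [lows_reflect_snd, highs_reflect_snd, gapEdge_reflect_snd] at key

end IsStripReeb

/-! ### Graph structure, degrees and orientation -/

namespace IsStripReeb

variable {R : Type*} [TopologicalSpace R] {c : ℝ → ℝ} {S : Set ℝ} {a : ℝ} {π : ℝ × ℝ → R}
  {g : R → ℝ}

theorem mem_edges_iff (hR : IsStripReeb c a π g) (h : IsTame c S a) (e : Set R) :
    e ∈ edges (lows c S π ∪ highs c S a π) ↔
      (∃ s ∈ S, e = coreEdge c a π s) ∨ ∃ t, t ∉ S ∧ e = gapEdge c S a π t := by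
  constructor
  · rintro ⟨x, hx, rfl⟩
    rcases hR.mem_coreEdge_or_gapEdge hx with ⟨s, hs, hxs⟩ | ⟨t, ht, hxt⟩
    · exact Or.inl ⟨s, hs, (hR.isMonotoneEdge_coreEdge h hs).component x hxs⟩
    · exact Or.inr ⟨t, ht, (hR.isMonotoneEdge_gapEdge h ht).component x hxt⟩
  · rintro (⟨s, hs, rfl⟩ | ⟨t, ht, rfl⟩)
    · exact (hR.isMonotoneEdge_coreEdge h hs).mem_edges
    · exact (hR.isMonotoneEdge_gapEdge h ht).mem_edges

/-- Every edge is monotone. -/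
theorem exists_isMonotoneEdge (hR : IsStripReeb c a π g) (h : IsTame c S a) {e : Set R}
    (he : e ∈ edges (lows c S π ∪ highs c S a π)) :
    ∃ L H, IsMonotoneEdge (lows c S π ∪ highs c S a π) L H g e := by
  rcases (hR.mem_edges_iff h e).1 he with ⟨s, hs, rfl⟩ | ⟨t, ht, rfl⟩
  · exact ⟨_, _, hR.isMonotoneEdge_coreEdge h hs⟩
  · exact ⟨_, _, hR.isMonotoneEdge_gapEdge h ht⟩

/-- The edges that meet the neighbourhood of a contour over the star of `s`. -/
theorem eq_coreEdge_or_gapEdge_of_inter (hR : IsStripReeb c a π g) (h : IsTame c S a) {s : ℝ}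
    (hs : s ∈ S) {e : Set R} (he : e ∈ edges (lows c S π ∪ highs c S a π))
    (hne : (closure e ∩ starNhd c S a π s).Nonempty) :
    e = coreEdge c a π s ∨ ∃ t ∈ star c S s, t ∉ S ∧ e = gapEdge c S a π t := by
  rw [closure_inter_open_nonempty_iff (hR.isOpen_starNhd h s)] at hne
  rcases (hR.mem_edges_iff h e).1 he with ⟨s', hs', rfl⟩ | ⟨t, ht, rfl⟩
  · exact Or.inl (hR.coreEdge_eq h hs hs' (mem_star_of_coreEdge hne))
  · exact Or.inr ⟨t, mem_star_of_gapEdge hne, ht, rfl⟩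

theorem encard_edges_inter_le (hR : IsStripReeb c a π g) (h : IsTame c S a) {s : ℝ}
    (hs : s ∈ S) : {e | e ∈ edges (lows c S π ∪ highs c S a π) ∧
      (closure e ∩ starNhd c S a π s).Nonempty}.encard ≤ 3 := by
  calc _ ≤ (insert (coreEdge c a π s)
        {e | ∃ t ∈ star c S s, t ∉ S ∧ e = gapEdge c S a π t}).encard :=
        encard_le_encard fun e he => hR.eq_coreEdge_or_gapEdge_of_inter h hs he.1 he.2
    _ ≤ _ := encard_insert_le _ _
    _ ≤ 2 + 1 := add_le_add_left (encard_gapEdges_le h hs) 1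
    _ = 3 := two_add_one_eq_three

theorem exists_coreEdge_of_mem_vertices (hR : IsStripReeb c a π g) (h : IsTame c S a) {v : R}
    (hv : v ∈ lows c S π ∪ highs c S a π) :
    ∃ s ∈ S, v ∈ starNhd c S a π s ∧ v ∈ closure (coreEdge c a π s) := by
  have key : ∀ s ∈ S, ∀ p ∈ Icc (c s) (c s + a),
      π (p, s) ∈ starNhd c S a π s ∧ π (p, s) ∈ closure (coreEdge c a π s) := by
    intro s hs p hp
    refine ⟨hR.mem_starNhd_of_mem h hs hp, ?_⟩
    have hlt : c s < c s + a := by linarith [h.pos]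
    have hγ : ContinuousOn (fun p => π (p, s)) (closure (Ioo (c s) (c s + a))) := by
      rw [closure_Ioo hlt.ne]
      exact hR.contOn.comp (by fun_prop) fun p hp => hp
    refine hγ.image_closure ⟨p, ?_, rfl⟩
    rwa [closure_Ioo hlt.ne]
  rcases hv with ⟨s, hs, rfl⟩ | ⟨s, hs, rfl⟩
  · exact ⟨s, hs, key s hs _ ⟨le_rfl, by linarith [h.pos]⟩⟩
  · exact ⟨s, hs, key s hs _ ⟨by linarith [h.pos], le_rfl⟩⟩

theorem locallyFinite_edges (hR : IsStripReeb c a π g) (h : IsTame c S a) :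
    LocallyFinite fun e : edges (lows c S π ∪ highs c S a π) => closure (e : Set R) := by
  intro q
  obtain ⟨s, hs, hq⟩ := hR.exists_mem_starNhd h q
  refine ⟨_, (hR.isOpen_starNhd h s).mem_nhds hq, ?_⟩
  have hfin := finite_of_encard_le_coe (k := 3) (hR.encard_edges_inter_le h hs)
  refine Finite.of_finite_image (f := Subtype.val) (hfin.subset ?_) Subtype.val_injective.injOn
  rintro _ ⟨e, he, rfl⟩
  exact ⟨e.2, he⟩

theorem iUnion_closure_edges (hR : IsStripReeb c a π g) (h : IsTame c S a) :
    ⋃ e : edges (lows c S π ∪ highs c S a π), closure (e : Set R) = univ := by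
  rw [eq_univ_iff_forall]
  intro q
  rw [mem_iUnion]
  by_cases hq : q ∈ lows c S π ∪ highs c S a π
  · obtain ⟨s, hs, -, hqs⟩ := hR.exists_coreEdge_of_mem_vertices h hq
    exact ⟨⟨_, (hR.isMonotoneEdge_coreEdge h hs).mem_edges⟩, hqs⟩
  · exact ⟨⟨_, q, hq, rfl⟩, subset_closure (mem_connectedComponentIn hq)⟩

theorem isGraphWithEnds (hR : IsStripReeb c a π g) (h : IsTame c S a) :
    IsGraphWithEnds R (lows c S π ∪ highs c S a π) where
  t2 := hR.t2Space h.cont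
  connected := hR.connectedSpace h.cont h.pos.le
  locallyCompact := by
    have := hR.t2Space h.cont
    refine locallyCompactSpace_of_locallyFinite (hR.locallyFinite_edges h)
      (fun e => isClosed_closure) (hR.iUnion_closure_edges h) fun e => ?_
    obtain ⟨L, H, he⟩ := hR.exists_isMonotoneEdge h e.2
    exact he.locallyCompactSpace
  edge e he := by
    obtain ⟨L, H, he⟩ := hR.exists_isMonotoneEdge h he
    exact he.shape
  weakTopology A hA := by
    -- The closed edges cover the space and are locally finite, so `A` is a locally finite union of
    -- closed sets.
    have : A = ⋃ e : edges (lows c S π ∪ highs c S a π), A ∩ closure (e : Set R) := by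
      rw [← inter_iUnion, hR.iUnion_closure_edges h, inter_univ]
    rw [this]
    exact ((hR.locallyFinite_edges h).subset fun e => inter_subset_right).isClosed_iUnion
      fun e => hA e e.2
  locallyFinite := hR.locallyFinite_edges h

theorem degree_eq_one_or (hR : IsStripReeb c a π g) (h : IsTame c S a) {v : R}
    (hv : v ∈ lows c S π ∪ highs c S a π) :
    degree (lows c S π ∪ highs c S a π) v = 1 ∨ degree (lows c S π ∪ highs c S a π) v = 2 ∨
      degree (lows c S π ∪ highs c S a π) v = 3 := by
  obtain ⟨s, hs, hvs, hve⟩ := hR.exists_coreEdge_of_mem_vertices h hv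
  have hle : degree (lows c S π ∪ highs c S a π) v ≤ 3 :=
    le_trans (encard_le_encard (fun _ he => And.intro he.1 ⟨v, he.2, hvs⟩))
      (hR.encard_edges_inter_le h hs)
  have hge : 1 ≤ degree (lows c S π ∪ highs c S a π) v :=
    one_le_encard_iff_nonempty.2 ⟨_, (hR.isMonotoneEdge_coreEdge h hs).mem_edges, hve⟩
  lift degree (lows c S π ∪ highs c S a π) v to ℕ using
    (hle.trans_lt (ENat.natCast_lt_top 3)).ne with n hn
  norm_cast at hle hge ⊢
  omega

/-- A core edge has its minimum at low vertices and its maximum at high ones, a gap edge the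
reverse. If both were incident to `v`, then `g` would take larger and smaller values near `v`. -/
theorem degree_eq_one_of_isLocalExtr (hR : IsStripReeb c a π g) (h : IsTame c S a) {v : R}
    (hv : v ∈ lows c S π ∪ highs c S a π) (hext : IsLocalExtr g v) :
    degree (lows c S π ∪ highs c S a π) v = 1 := by
  obtain ⟨s, hs, hvs, hve⟩ := hR.exists_coreEdge_of_mem_vertices h hv
  have hdisj := Set.disjoint_left.1 (hR.disjoint_lows_highs h)
  rw [degree, encard_eq_one]
  refine ⟨coreEdge c a π s, Subset.antisymm ?_ ?_⟩
  · rintro e ⟨he, hev⟩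
    rcases hR.eq_coreEdge_or_gapEdge_of_inter h hs he ⟨v, hev, hvs⟩ with h1 | ⟨t, -, ht, rfl⟩
    · exact h1
    · exfalso
      rcases (hR.isMonotoneEdge_coreEdge h hs).endpoint v hv hve with ⟨h1, -, h2⟩ | ⟨h1, -, h2⟩ <;>
      rcases (hR.isMonotoneEdge_gapEdge h ht).endpoint v hv hev with ⟨h3, -, h4⟩ | ⟨h3, -, h4⟩
      · exact hdisj h1 h3
      · rcases hext with hm | hm
        · exact h4 (hm.mono fun q hq => not_lt.2 hq)
        · exact h2 (hm.mono fun q hq => not_lt.2 hq)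
      · rcases hext with hm | hm
        · exact h2 (hm.mono fun q hq => not_lt.2 hq)
        · exact h4 (hm.mono fun q hq => not_lt.2 hq)
      · exact hdisj h3 h1
  · rintro _ rfl
    exact ⟨(hR.isMonotoneEdge_coreEdge h hs).mem_edges, hve⟩

theorem isDigraphBy (hR : IsStripReeb c a π g) (h : IsTame c S a) :
    IsDigraphBy (lows c S π ∪ highs c S a π) g where
  orientation e he v hv hve := by
    obtain ⟨L, H, he⟩ := hR.exists_isMonotoneEdge h he
    have hnot : ¬ (Departs g e v ∧ Enters g e v) := by
      rintro ⟨h1, h2⟩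
      obtain ⟨x, hx⟩ := he.nonempty
      have hgx : g x = g v := le_antisymm (h2.2 (subset_closure hx)) (h1.2 (subset_closure hx))
      have := he.injOn (subset_closure hx) hve hgx
      exact he.subset hx (this ▸ hv)
    rcases he.endpoint v hv hve with ⟨-, h1, -⟩ | ⟨-, h1, -⟩
    · exact Or.inl ⟨⟨hve, h1⟩, fun h2 => hnot ⟨⟨hve, h1⟩, h2⟩⟩
    · exact Or.inr ⟨⟨hve, h1⟩, fun h2 => hnot ⟨h2, ⟨hve, h1⟩⟩⟩
  departs_unique e he v hv u hu := by
    obtain ⟨L, H, he⟩ := hR.exists_isMonotoneEdge h he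
    exact he.injOn hv.2.1 hu.2.1 (le_antisymm (hv.2.2 hu.2.1) (hu.2.2 hv.2.1))
  enters_unique e he v hv u hu := by
    obtain ⟨L, H, he⟩ := hR.exists_isMonotoneEdge h he
    exact he.injOn hv.2.1 hu.2.1 (le_antisymm (hu.2.2 hv.2.1) (hv.2.2 hu.2.1))

end IsStripReeb

/-! ### Tameness from smoothness, and the closure of the region -/

theorem IsTS.isTame {c : ℝ → ℝ} {N a : ℝ} (hc : IsTS c) (hS : (criticalSet c).Nonempty)
    (hcons : ConsecutiveValuesDifferBy c N) (ha : 0 < a) (haN : a < N) :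
    IsTame c (criticalSet c) a where
  pos := ha
  cont := hc.1.continuous
  closed := isClosed_eq (hc.1.continuous_deriv (by norm_num)) continuous_const
  nonempty := hS
  const x y hxy := by
    have key : ∀ x y, x < y → Icc x y ⊆ criticalSet c → c x = c y := by
      intro x y hxy hsub
      obtain ⟨z, hz, he⟩ := exists_deriv_eq_slope c hxy hc.1.continuous.continuousOn
        (hc.1.differentiable (by norm_num)).differentiableOn
      rw [hsub (Ioo_subset_Icc_self hz), eq_comm, div_eq_zero_iff] at he
      rcases he with he | he <;> linarith
    rcases lt_trichotomy x y with h | h | h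
    · exact key x y h (by rwa [uIcc_of_le h.le] at hxy)
    · rw [h]
    · exact (key y x h (by rwa [uIcc_of_ge h.le] at hxy)).symm
  mono I hI hd := by
    have hconv : Convex ℝ I := hI.convex
    have hdiff : Differentiable ℝ c := hc.1.differentiable (by norm_num)
    -- Darboux's theorem: a derivative without zeros on an interval has constant sign.
    rcases hasDerivWithinAt_forall_lt_or_forall_gt_of_forall_ne hconv.interior (f := c)
      (f' := deriv c) (m := 0) (fun x _ => (hdiff x).hasDerivAt.hasDerivWithinAt)
      (fun x hx h0 => Set.disjoint_left.1 hd hx h0) with h | h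
    · exact Or.inr (strictAntiOn_of_deriv_neg hconv hdiff.continuous.continuousOn h)
    · exact Or.inl (strictMonoOn_of_deriv_pos hconv hdiff.continuous.continuousOn h)
  gap x y hxy hx hy hd := haN.trans (hcons x y hxy hx hy hd)

theorem closure_region (c : ℝ → ℝ) {a : ℝ} (hc : Continuous c) (ha : 0 < a) :
    closure (region c fun x => c x + a) = strip c a := by
  refine Subset.antisymm (closure_minimal (fun x hx => ⟨hx.1.le, hx.2.le⟩)
    (IsStripReeb.isClosed_strip hc)) fun x hx => ?_
  have h1 : x.1 ∈ closure (Ioo (c x.2) (c x.2 + a)) := by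
    rw [closure_Ioo (by linarith)]
    exact hx
  have h2 : (fun p => (p, x.2)) '' Ioo (c x.2) (c x.2 + a) ⊆ region c fun x => c x + a := by
    rintro _ ⟨p, hp, rfl⟩
    exact hp
  exact closure_mono h2 (image_closure_subset_closure_image (by fun_prop) ⟨x.1, h1, rfl⟩)

/-! ### Contours of the hypersurface -/

section Hypersurface

variable {m : ℕ} {c : ℝ → ℝ} {a : ℝ}

/-- The square of the radius of the sphere over a point of the strip. -/
def radiusSq (c : ℝ → ℝ) (a : ℝ) (w : ℝ × ℝ) : ℝ := (w.1 - c w.2) * (c w.2 + a - w.1)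

theorem continuous_radiusSq (hc : Continuous c) : Continuous (radiusSq c a) := by
  unfold radiusSq
  fun_prop

/-- The two factors add up to `a > 0`, so they cannot both be nonpositive. -/
theorem mem_strip_iff_radiusSq (ha : 0 < a) {w : ℝ × ℝ} : w ∈ strip c a ↔ 0 ≤ radiusSq c a w := by
  constructor
  · rintro ⟨h1, h2⟩
    exact mul_nonneg (by linarith) (by linarith)
  · intro h
    rw [radiusSq, mul_nonneg_iff] at h
    rcases h with ⟨h1, h2⟩ | ⟨h1, h2⟩
    · constructor <;> linarith
    · constructor <;> linarith

theorem radiusSq_eq_zero_iff {w : ℝ × ℝ} :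
    radiusSq c a w = 0 ↔ w.1 = c w.2 ∨ w.1 = c w.2 + a := by
  rw [radiusSq, mul_eq_zero]
  constructor <;> rintro (h | h)
  · left; linarith
  · right; linarith
  · left; linarith
  · right; linarith

theorem mem_hypersurface_iff (hc : Continuous c) (ha : 0 < a) {z : Ambient m} :
    z ∈ hypersurface m c (fun x => c x + a) ↔ ‖z.2‖ ^ 2 = radiusSq c a z.1 := by
  rw [hypersurface, mem_ofPred_eq, closure_region c hc ha, EuclideanSpace.norm_sq_eq]
  simp only [Real.norm_eq_abs, sq_abs]
  constructor
  · rintro ⟨-, h⟩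
    rw [radiusSq]
    linarith
  · intro h
    refine ⟨(mem_strip_iff_radiusSq ha).2 (h ▸ Finset.sum_nonneg fun i _ => sq_nonneg _), ?_⟩
    rw [h, radiusSq, sub_self]

theorem fst_mem_strip (hc : Continuous c) (ha : 0 < a)
    (z : hypersurface m c fun x => c x + a) : z.1.1 ∈ strip c a := by
  rw [mem_strip_iff_radiusSq ha, ← (mem_hypersurface_iff hc ha).1 z.2]
  positivity

theorem smul_mem_hypersurface (hc : Continuous c) (ha : 0 < a) {w : ℝ × ℝ}
    (hw : w ∈ strip c a) {u : EuclideanSpace ℝ (Fin (m - 1))} (hu : ‖u‖ = 1) :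
    ((w, √(radiusSq c a w) • u) : Ambient m) ∈ hypersurface m c (fun x => c x + a) := by
  rw [mem_hypersurface_iff hc ha, norm_smul, hu, mul_one, Real.norm_eq_abs, sq_abs,
    Real.sq_sqrt ((mem_strip_iff_radiusSq ha).1 hw)]

theorem exists_norm_eq_one (hm : 2 ≤ m) : ∃ u : EuclideanSpace ℝ (Fin (m - 1)), ‖u‖ = 1 :=
  ⟨EuclideanSpace.single ⟨0, by omega⟩ 1, by simp⟩

theorem exists_eq_smul (hc : Continuous c) (ha : 0 < a) (hm : 2 ≤ m)
    (z : hypersurface m c fun x => c x + a) :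
    ∃ u : EuclideanSpace ℝ (Fin (m - 1)), ‖u‖ = 1 ∧ z.1 = (z.1.1, √(radiusSq c a z.1.1) • u) := by
  have h := (mem_hypersurface_iff hc ha).1 z.2
  by_cases h0 : z.1.2 = 0
  · obtain ⟨u, hu⟩ := exists_norm_eq_one hm
    refine ⟨u, hu, ?_⟩
    rw [← h]
    simp [h0, Prod.ext_iff]
  · refine ⟨‖z.1.2‖⁻¹ • z.1.2, norm_smul_inv_norm (𝕜 := ℝ) h0, ?_⟩
    rw [← h, Real.sqrt_sq (norm_nonneg _), smul_smul, mul_inv_cancel₀ (norm_ne_zero_iff.2 h0),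
      one_smul]

/-- The points `z` and `z'` lie in a connected subset of a level set in the hypersurface. -/
def LevelJoined (m : ℕ) (c : ℝ → ℝ) (a p : ℝ) (z z' : Ambient m) : Prop :=
  ∃ B : Set (Ambient m), IsPreconnected B ∧ z ∈ B ∧ z' ∈ B ∧
    ∀ w ∈ B, w ∈ hypersurface m c (fun x => c x + a) ∧ w.1.1 = p

theorem LevelJoined.trans {p : ℝ} {z z' z'' : Ambient m} (h : LevelJoined m c a p z z')
    (h' : LevelJoined m c a p z' z'') : LevelJoined m c a p z z'' := by
  obtain ⟨B, hB, h1, h2, h3⟩ := h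
  obtain ⟨B', hB', h1', h2', h3'⟩ := h'
  refine ⟨B ∪ B', hB.union z' h2 h1' hB', Or.inl h1, Or.inr h2', ?_⟩
  rintro w (hw | hw)
  · exact h3 w hw
  · exact h3' w hw

theorem LevelJoined.symm {p : ℝ} {z z' : Ambient m} (h : LevelJoined m c a p z z') :
    LevelJoined m c a p z' z := by
  obtain ⟨B, hB, h1, h2, h3⟩ := h
  exact ⟨B, hB, h2, h1, h3⟩

theorem levelJoined_of_uIcc (hc : Continuous c) (ha : 0 < a) {p t t' : ℝ}
    (hd : ∀ r ∈ uIcc t t', (p, r) ∈ strip c a) {u : EuclideanSpace ℝ (Fin (m - 1))}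
    (hu : ‖u‖ = 1) :
    LevelJoined m c a p ((p, t), √(radiusSq c a (p, t)) • u)
      ((p, t'), √(radiusSq c a (p, t')) • u) := by
  have hcont : Continuous fun r : ℝ => (((p, r), √(radiusSq c a (p, r)) • u) : Ambient m) := by
    have := continuous_radiusSq (a := a) hc
    fun_prop
  refine ⟨_, isPreconnected_uIcc.image _ hcont.continuousOn, ⟨t, left_mem_uIcc, rfl⟩,
    ⟨t', right_mem_uIcc, rfl⟩, ?_⟩
  rintro _ ⟨r, hr, rfl⟩
  exact ⟨smul_mem_hypersurface hc ha (hd r hr) hu, rfl⟩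

/-- The unit sphere of a space of dimension `m - 1 ≥ 2` is connected, so position and direction can
be varied together. -/
theorem levelJoined_of_line (hc : Continuous c) (ha : 0 < a) (hm : 3 ≤ m) {p : ℝ}
    (hd : ∀ r, (p, r) ∈ strip c a) (t t' : ℝ) {u u' : EuclideanSpace ℝ (Fin (m - 1))}
    (hu : ‖u‖ = 1) (hu' : ‖u'‖ = 1) :
    LevelJoined m c a p ((p, t), √(radiusSq c a (p, t)) • u)
      ((p, t'), √(radiusSq c a (p, t')) • u') := by
  have hcont : Continuous fun v : ℝ × EuclideanSpace ℝ (Fin (m - 1)) =>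
      (((p, v.1), √(radiusSq c a (p, v.1)) • v.2) : Ambient m) := by
    have := continuous_radiusSq (a := a) hc
    fun_prop
  have hrank : 1 < Module.rank ℝ (EuclideanSpace ℝ (Fin (m - 1))) := by
    rw [← Module.finrank_eq_rank, finrank_euclideanSpace_fin]
    exact_mod_cast (by omega : 1 < m - 1)
  refine ⟨_, (isPreconnected_univ.prod (isPreconnected_sphere hrank 0 1)).image _
    hcont.continuousOn, ⟨(t, u), ⟨trivial, by simpa using hu⟩, rfl⟩,
    ⟨(t', u'), ⟨trivial, by simpa using hu'⟩, rfl⟩, ?_⟩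
  rintro _ ⟨v, ⟨-, hv⟩, rfl⟩
  exact ⟨smul_mem_hypersurface hc ha (hd _) (by simpa using hv), rfl⟩

theorem exists_radiusSq_eq_zero (hc : Continuous c) (ha : 0 < a) {p t t₁ : ℝ}
    (ht : (p, t) ∈ strip c a) (ht₁ : radiusSq c a (p, t₁) ≤ 0) :
    ∃ t₀, radiusSq c a (p, t₀) = 0 ∧ ∀ r ∈ uIcc t t₀, (p, r) ∈ strip c a := by
  have hq : Continuous fun r => radiusSq c a (p, r) :=
    (continuous_radiusSq hc).comp (by fun_prop)
  have hclosed : IsClosed {r | radiusSq c a (p, r) = 0} := isClosed_eq hq continuous_const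
  have hpos := (mem_strip_iff_radiusSq ha).1 ht
  simp only [mem_strip_iff_radiusSq ha]
  obtain ⟨z, hz, hz0⟩ := intermediate_value_uIcc (a := t) (b := t₁) hq.continuousOn
    (mem_uIcc_of_ge ht₁ hpos)
  -- Before the first zero the radius function cannot become negative, by the intermediate value
  -- theorem.
  have hno : ∀ t₀, (∀ r ∈ uIcc t t₀, radiusSq c a (p, r) = 0 → r = t₀) →
      radiusSq c a (p, t₀) = 0 → ∀ r ∈ uIcc t t₀, 0 ≤ radiusSq c a (p, r) := by
    intro t₀ hfirst h0 r hr
    by_contra! hneg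
    obtain ⟨y, hy, hy0⟩ := intermediate_value_uIcc (a := t) (b := r) hq.continuousOn
      (mem_uIcc_of_ge hneg.le hpos)
    have he := hfirst y (uIcc_subset_uIcc left_mem_uIcc hr hy) hy0
    have : r = t₀ := by
      rw [he] at hy
      rw [mem_uIcc] at hy hr
      rcases hy with h1 | h1 <;> rcases hr with h2 | h2 <;> linarith
    rw [this, h0] at hneg
    exact lt_irrefl _ hneg
  rcases le_total t z with hle | hle
  · obtain ⟨x, hx, htx, -, hd⟩ := exists_first_mem hclosed hz0 hle
    refine ⟨x, hx, hno x (fun r hr hr0 => ?_) hx⟩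
    rw [uIcc_of_le htx] at hr
    by_contra hne
    exact hd r ⟨hr.1, lt_of_le_of_ne hr.2 hne⟩ hr0
  · obtain ⟨x, hx, -, hxt, hd⟩ := exists_last_mem hclosed hz0 hle
    refine ⟨x, hx, hno x (fun r hr hr0 => ?_) hx⟩
    rw [uIcc_of_ge hxt] at hr
    by_contra hne
    exact hd r ⟨lt_of_le_of_ne hr.1 (Ne.symm hne), hr.2⟩ hr0

/-- If the line at this level has a point with `radiusSq ≤ 0`, both points slide with fixed
directions to one boundary point, where the sphere has collapsed and directions no longer matter.
Otherwise the line lies in the region, which forces `m ≥ 3`. -/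
theorem levelJoined (hc : Continuous c) (ha : 0 < a) (hm : 2 ≤ m)
    (hline : m = 2 → ∀ p : ℝ, ∃ t : ℝ, (p, t) ∉ region c fun x => c x + a)
    {z z' : hypersurface m c fun x => c x + a} (hp : z.1.1.1 = z'.1.1.1)
    (hd : ∀ r ∈ uIcc z.1.1.2 z'.1.1.2, (z.1.1.1, r) ∈ strip c a) :
    LevelJoined m c a z.1.1.1 z.1 z'.1 := by
  obtain ⟨u, hu, hz⟩ := exists_eq_smul hc ha hm z
  obtain ⟨u', hu', hz'⟩ := exists_eq_smul hc ha hm z'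
  rw [show z'.1.1 = (z.1.1.1, z'.1.1.2) by rw [hp]] at hz'
  rw [hz, hz']
  by_cases hex : ∃ t₁, radiusSq c a (z.1.1.1, t₁) ≤ 0
  · obtain ⟨t₁, ht₁⟩ := hex
    obtain ⟨t₀, h0, hd₀⟩ := exists_radiusSq_eq_zero hc ha (hd _ left_mem_uIcc) ht₁
    have hd₁ : ∀ r ∈ uIcc z'.1.1.2 t₀, (z.1.1.1, r) ∈ strip c a := by
      intro r hr
      rcases uIcc_subset_uIcc_union_uIcc (b := z.1.1.2) hr with h1 | h1
      · exact hd r (by rwa [uIcc_comm])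
      · exact hd₀ r h1
    have h1 := levelJoined_of_uIcc hc ha hd₀ hu
    have h2 := levelJoined_of_uIcc hc ha hd₁ hu'
    rw [h0, Real.sqrt_zero, zero_smul] at h1 h2
    exact h1.trans h2.symm
  · push Not at hex
    have hm3 : m ≠ 2 := by
      intro hm2
      obtain ⟨t, ht⟩ := hline hm2 z.1.1.1
      have hpos := hex t
      have hst := (mem_strip_iff_radiusSq (w := (z.1.1.1, t)) ha).2 hpos.le
      refine ht ⟨lt_of_le_of_ne hst.1 fun h => hpos.ne' ?_, lt_of_le_of_ne hst.2 fun h => hpos.ne' ?_⟩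
      · exact radiusSq_eq_zero_iff.2 (Or.inl h.symm)
      · exact radiusSq_eq_zero_iff.2 (Or.inr h)
    exact levelJoined_of_line hc ha (by omega)
      (fun r => (mem_strip_iff_radiusSq ha).2 (hex r).le) _ _ hu hu'

theorem reebMk_eq_iff (hc : Continuous c) (ha : 0 < a) (hm : 2 ≤ m)
    (hline : m = 2 → ∀ p : ℝ, ∃ t : ℝ, (p, t) ∉ region c fun x => c x + a)
    (z z' : hypersurface m c fun x => c x + a) :
    reebMk (height m c fun x => c x + a) z = reebMk (height m c fun x => c x + a) z' ↔
      z.1.1.1 = z'.1.1.1 ∧ ∀ r ∈ uIcc z.1.1.2 z'.1.1.2, (z.1.1.1, r) ∈ strip c a := by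
  set f := height m c fun x => c x + a with hf
  have hmk : reebMk f z = reebMk f z' ↔ contour f z = contour f z' := Quotient.eq
  rw [hmk]
  constructor
  · intro h
    have hp : z.1.1.1 = z'.1.1.1 := eq_of_reebSetoid f z z' h
    refine ⟨hp, fun r hr => ?_⟩
    have hz : z ∈ contour f z := mem_connectedComponentIn rfl
    have hz' : z' ∈ contour f z := h ▸ mem_connectedComponentIn rfl
    have hpre : IsPreconnected ((fun w : hypersurface m c fun x => c x + a => w.1.1.2) ''
        contour f z) :=
      isPreconnected_connectedComponentIn.image _ (Continuous.continuousOn (by fun_prop))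
    obtain ⟨w, hw, rfl⟩ := hpre.ordConnected.uIcc_subset ⟨z, hz, rfl⟩ ⟨z', hz', rfl⟩ hr
    have hwz : w.1.1.1 = z.1.1.1 := connectedComponentIn_subset (f ⁻¹' {f z}) z hw
    rw [← hwz]
    exact fst_mem_strip hc ha w
  · rintro ⟨hp, hd⟩
    obtain ⟨B, hB, hzB, hz'B, hBX⟩ := levelJoined hc ha hm hline hp hd
    have hpre : IsPreconnected (Subtype.val ⁻¹' B : Set (hypersurface m c fun x => c x + a)) := by
      rw [← IsInducing.subtypeVal.isPreconnected_image, image_preimage_eq_inter_range,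
        Subtype.range_coe, inter_eq_left.2 fun w hw => (hBX w hw).1]
      exact hB
    have hsub : z' ∈ connectedComponentIn (f ⁻¹' {f z}) z :=
      hpre.subset_connectedComponentIn hzB (fun w hw => (hBX w hw).2) hz'B
    have hlev : f z = f z' := hp
    have := connectedComponentIn_eq hsub
    rw [contour, contour, this, hlev]

/-- The nearest point of the strip on the horizontal line. -/
def clampStrip (c : ℝ → ℝ) (a : ℝ) (w : ℝ × ℝ) : ℝ × ℝ :=
  (max (c w.2) (min w.1 (c w.2 + a)), w.2)

theorem clampStrip_mem (ha : 0 < a) (w : ℝ × ℝ) : clampStrip c a w ∈ strip c a :=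
  ⟨le_max_left _ _, max_le (by simp only [clampStrip]; linarith) (min_le_right _ _)⟩

theorem clampStrip_of_mem {w : ℝ × ℝ} (hw : w ∈ strip c a) : clampStrip c a w = w := by
  rw [clampStrip, min_eq_left hw.2, max_eq_right hw.1]

/-- The quotient map from the strip to the Reeb space of the height of the hypersurface, for a
unit vector `u`. -/
noncomputable def stripMk (hc : Continuous c) (ha : 0 < a)
    {u : EuclideanSpace ℝ (Fin (m - 1))} (hu : ‖u‖ = 1) (w : ℝ × ℝ) :
    ReebSpace (height m c fun x => c x + a) :=
  -- Clamping makes the map total and continuous on the plane; only its values on the strip matter.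
  reebMk _ ⟨_, smul_mem_hypersurface hc ha (clampStrip_mem ha w) hu⟩

theorem reebMk_eq_stripMk (hc : Continuous c) (ha : 0 < a) (hm : 2 ≤ m)
    (hline : m = 2 → ∀ p : ℝ, ∃ t : ℝ, (p, t) ∉ region c fun x => c x + a)
    {u : EuclideanSpace ℝ (Fin (m - 1))} (hu : ‖u‖ = 1)
    (z : hypersurface m c fun x => c x + a) :
    reebMk (height m c fun x => c x + a) z = stripMk hc ha hu z.1.1 := by
  rw [stripMk, reebMk_eq_iff hc ha hm hline]
  simp only [clampStrip_of_mem (fst_mem_strip hc ha z), uIcc_self, mem_singleton_iff, true_and]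
  rintro r rfl
  exact fst_mem_strip hc ha z

theorem isStripReeb_stripMk (hc : Continuous c) (ha : 0 < a) (hm : 2 ≤ m)
    (hline : m = 2 → ∀ p : ℝ, ∃ t : ℝ, (p, t) ∉ region c fun x => c x + a)
    {u : EuclideanSpace ℝ (Fin (m - 1))} (hu : ‖u‖ = 1) :
    IsStripReeb c a (stripMk hc ha hu) (reebInduced (height m c fun x => c x + a)) where
  contOn := by
    refine Continuous.continuousOn ?_
    refine Continuous.comp (g := reebMk _) continuous_quot_mk (Continuous.subtype_mk ?_ _)
    have := continuous_radiusSq (a := a) hc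
    have h2 : Continuous (clampStrip c a) := by unfold clampStrip; fun_prop
    fun_prop
  surj q := by
    obtain ⟨z, rfl⟩ := Quotient.exists_rep q
    exact ⟨z.1.1, fst_mem_strip hc ha z, (reebMk_eq_stripMk hc ha hm hline hu z).symm⟩
  isOpen U O hO h := by
    have hpre : reebMk (height m c fun x => c x + a) ⁻¹' U = (fun z => z.1.1) ⁻¹' O := by
      ext z
      rw [mem_preimage, reebMk_eq_stripMk hc ha hm hline hu, h _ (fst_mem_strip hc ha z)]
      rfl
    refine (isQuotientMap_quot_mk.isOpen_preimage (s := U)).1 ?_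
    have : IsOpen (reebMk (height m c fun x => c x + a) ⁻¹' U) := by
      rw [hpre]
      exact hO.preimage (by fun_prop)
    exact this
  eq_iff w hw w' hw' := by
    rw [stripMk, stripMk, reebMk_eq_iff hc ha hm hline]
    simp only [clampStrip_of_mem hw, clampStrip_of_mem hw']
  val w hw := by
    change (clampStrip c a w).1 = w.1
    rw [clampStrip_of_mem hw]

end Hypersurface

/-! ### Critical points of the height -/

section CriticalPoints

variable {m : ℕ} {c : ℝ → ℝ} {a : ℝ}

theorem fderiv_proj (z v : Ambient m) : fderiv ℝ (proj m) z v = v.1.1 := by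
  have h : HasFDerivAt (proj m) ((ContinuousLinearMap.fst ℝ ℝ ℝ).comp
      (ContinuousLinearMap.fst ℝ (ℝ × ℝ) (EuclideanSpace ℝ (Fin (m - 1))))) z :=
    hasFDerivAt_fst.comp z hasFDerivAt_fst
  rw [h.fderiv]
  rfl

theorem radiusSq_add_half (w : ℝ × ℝ) (d : ℝ) :
    radiusSq c a (c w.2 + a / 2 + d, w.2) = (a / 2) ^ 2 - d ^ 2 := by
  rw [radiusSq]
  ring

/-- With `x₂` and the direction of `y` fixed, the hypersurface contains a circle of radius `a / 2`
centred at `x₁ = c t + a / 2`. Rotating along it moves `x₁` with speed `‖y‖ ≠ 0`. -/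
theorem not_isCriticalPointOn_of_ne_zero (hc : Continuous c) (ha : 0 < a) {z : Ambient m}
    (hz : z ∈ hypersurface m c fun x => c x + a) (hy : z.2 ≠ 0) :
    ¬ IsCriticalPointOn (hypersurface m c fun x => c x + a) (proj m) z := by
  rintro ⟨-, hcrit⟩
  obtain ⟨⟨p, t⟩, y⟩ := z
  simp only at hy
  have hn : ‖y‖ ≠ 0 := norm_ne_zero_iff.2 hy
  set d := p - c t - a / 2 with hd
  have hp : p = c t + a / 2 + d := by rw [hd]; ring
  have hsq : ‖y‖ ^ 2 = (a / 2) ^ 2 - d ^ 2 := by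
    rw [(mem_hypersurface_iff hc ha).1 hz, hp]
    exact radiusSq_add_half (p, t) d
  have h1 : HasDerivAt (fun θ : ℝ => c t + a / 2 + (d * Real.cos θ + ‖y‖ * Real.sin θ))
      ‖y‖ 0 := by
    have := (((Real.hasDerivAt_cos 0).const_mul d).add
      ((Real.hasDerivAt_sin 0).const_mul ‖y‖)).const_add (c t + a / 2)
    simpa using this
  have h2 : HasDerivAt (fun θ : ℝ => (Real.cos θ - d / ‖y‖ * Real.sin θ) • y)
      ((-(d / ‖y‖)) • y) 0 := by
    have := ((Real.hasDerivAt_cos 0).sub ((Real.hasDerivAt_sin 0).const_mul (d / ‖y‖))).smul_const y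
    simpa using this
  have key := hcrit ((‖y‖, 0), (-(d / ‖y‖)) • y)
    ⟨fun θ => ((c t + a / 2 + (d * Real.cos θ + ‖y‖ * Real.sin θ), t),
      (Real.cos θ - d / ‖y‖ * Real.sin θ) • y), ?_, ?_, ?_, (h1.prodMk (hasDerivAt_const _ _)).prodMk h2⟩
  · rw [fderiv_proj] at key
    exact hn key
  · have hcos : ContDiff ℝ ∞ Real.cos := Real.contDiff_cos
    have hsin : ContDiff ℝ ∞ Real.sin := Real.contDiff_sin
    exact ContDiff.contDiffAt (by fun_prop)
  · simp [hp]
  · refine Filter.Eventually.of_forall fun θ => ?_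
    rw [mem_hypersurface_iff hc ha]
    have := radiusSq_add_half (c := c) (a := a) (p, t) (d * Real.cos θ + ‖y‖ * Real.sin θ)
    simp only at this ⊢
    rw [this, norm_smul, mul_pow, Real.norm_eq_abs, sq_abs]
    have h3 : (Real.cos θ - d / ‖y‖ * Real.sin θ) ^ 2 * ‖y‖ ^ 2 =
        (‖y‖ * Real.cos θ - d * Real.sin θ) ^ 2 := by
      rw [← mul_pow]
      congr 1
      field_simp
    rw [h3]
    have h4 := Real.sin_sq_add_cos_sq θ
    linear_combination (‖y‖ ^ 2 + d ^ 2) * h4 + hsq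

/-- The boundary graph, at height `y = 0`, is a curve in the hypersurface along which `x₁` changes
at the rate `deriv c t`. -/
theorem not_isCriticalPointOn_of_deriv_ne_zero (hc : ContDiff ℝ ∞ c) (ha : 0 < a)
    {z : Ambient m} (hz : z ∈ hypersurface m c fun x => c x + a) (hy : z.2 = 0)
    (hd : deriv c z.1.2 ≠ 0) :
    ¬ IsCriticalPointOn (hypersurface m c fun x => c x + a) (proj m) z := by
  rintro ⟨-, hcrit⟩
  have hr := (mem_hypersurface_iff hc.continuous ha).1 hz
  obtain ⟨⟨p, t⟩, y⟩ := z
  obtain rfl : y = 0 := hy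
  simp only [norm_zero, ne_eq, OfNat.ofNat_ne_zero, not_false_eq_true, zero_pow] at hr
  obtain ⟨k, hk, hp⟩ : ∃ k, (k = 0 ∨ k = a) ∧ p = c t + k := by
    rcases radiusSq_eq_zero_iff.1 hr.symm with h | h
    · exact ⟨0, Or.inl rfl, by simpa using h⟩
    · exact ⟨a, Or.inr rfl, h⟩
  have hct : HasDerivAt c (deriv c t) (t + 0) := by
    rw [add_zero]
    exact (hc.differentiable (by norm_num) t).hasDerivAt
  have hadd : HasDerivAt (fun θ : ℝ => t + θ) 1 0 := (hasDerivAt_id 0).const_add t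
  have h1 : HasDerivAt (fun θ : ℝ => c (t + θ) + k) (deriv c t) 0 := by
    have := (hct.comp 0 hadd).add_const k
    simpa using this
  have key := hcrit ((deriv c t, 1), 0)
    ⟨fun θ => ((c (t + θ) + k, t + θ), 0), ?_, ?_, ?_, (h1.prodMk hadd).prodMk (hasDerivAt_const _ _)⟩
  · rw [fderiv_proj] at key
    exact hd key
  · exact ContDiff.contDiffAt (by fun_prop)
  · simp [hp]
  · refine Filter.Eventually.of_forall fun θ => ?_
    rw [mem_hypersurface_iff hc.continuous ha]
    simp only [norm_zero, ne_eq, OfNat.ofNat_ne_zero, not_false_eq_true, zero_pow]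
    refine (radiusSq_eq_zero_iff.2 ?_).symm
    rcases hk with rfl | rfl
    · left; simp
    · right; rfl

/-- Differentiating the defining equation along a curve leaves, where `y = 0` and `c' = 0`, the
velocity of `x₁` times `a` or `-a`, depending on the boundary graph; hence that velocity vanishes.
-/
theorem isCriticalPointOn_of_deriv_eq_zero (hc : ContDiff ℝ ∞ c) (ha : 0 < a)
    {z : Ambient m} (hz : z ∈ hypersurface m c fun x => c x + a) (hy : z.2 = 0)
    (hd : deriv c z.1.2 = 0) :
    IsCriticalPointOn (hypersurface m c fun x => c x + a) (proj m) z := by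
  refine ⟨hz, ?_⟩
  rintro v ⟨γ, -, hγ0, hγ, hv⟩
  rw [fderiv_proj]
  have hr := (mem_hypersurface_iff hc.continuous ha).1 hz
  rw [hy, norm_zero, eq_comm, zero_pow two_ne_zero, radiusSq_eq_zero_iff] at hr
  have hv1 : HasDerivAt (fun θ => (γ θ).1.1) v.1.1 0 := hv.fst.fst
  have hv2 : HasDerivAt (fun θ => (γ θ).1.2) v.1.2 0 := hv.fst.snd
  have hv3 : HasDerivAt (fun θ => (γ θ).2) v.2 0 := hv.snd
  have hct : HasDerivAt c 0 (γ 0).1.2 := by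
    rw [hγ0, ← hd]
    exact (hc.differentiable (by norm_num) _).hasDerivAt
  have hcc : HasDerivAt (fun θ => c (γ θ).1.2) 0 0 := by
    have := hct.comp (0 : ℝ) hv2
    rwa [zero_mul] at this
  have hF := ((hv1.sub hcc).mul ((hcc.add_const a).sub hv1)).sub hv3.norm_sq
  have hF0 : HasDerivAt (fun _ : ℝ => (0 : ℝ)) 0 0 := hasDerivAt_const _ _
  have huniq := (hF0.congr_of_eventuallyEq (hγ.mono fun θ hθ => ?_)).unique hF
  · simp only [Pi.sub_apply, hγ0, hy, inner_zero_left] at huniq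
    rcases hr with hr | hr <;> rw [hr] at huniq <;> simp at huniq <;>
      rcases huniq with h | h <;> first | exact h | exact absurd h ha.ne'
  · have := (mem_hypersurface_iff hc.continuous ha).1 hθ
    simp [radiusSq] at this ⊢
    linarith

theorem isCriticalPointOn_iff (hc : ContDiff ℝ ∞ c) (ha : 0 < a)
    {z : Ambient m} (hz : z ∈ hypersurface m c fun x => c x + a) :
    IsCriticalPointOn (hypersurface m c fun x => c x + a) (proj m) z ↔
      z.2 = 0 ∧ z.1.2 ∈ criticalSet c := by
  refine ⟨fun h => ?_, fun h => isCriticalPointOn_of_deriv_eq_zero hc ha hz h.1 h.2⟩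
  have hy : z.2 = 0 := by
    by_contra hy
    exact not_isCriticalPointOn_of_ne_zero hc.continuous ha hz hy h
  refine ⟨hy, ?_⟩
  by_contra hd
  exact not_isCriticalPointOn_of_deriv_ne_zero hc ha hz hy hd h

theorem reebVertices_eq (hc : ContDiff ℝ ∞ c) (ha : 0 < a) (hm : 2 ≤ m)
    (hline : m = 2 → ∀ p : ℝ, ∃ t : ℝ, (p, t) ∉ region c fun x => c x + a)
    {u : EuclideanSpace ℝ (Fin (m - 1))} (hu : ‖u‖ = 1) :
    reebVertices m c (fun x => c x + a) =
      lows c (criticalSet c) (stripMk hc.continuous ha hu) ∪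
        highs c (criticalSet c) a (stripMk hc.continuous ha hu) := by
  have hmk := reebMk_eq_stripMk hc.continuous ha hm hline hu
  ext q
  constructor
  · rintro ⟨z, hz, rfl⟩
    obtain ⟨hy, hd⟩ := (isCriticalPointOn_iff hc ha z.2).1 hz
    have hr := (mem_hypersurface_iff hc.continuous ha).1 z.2
    rw [hy, norm_zero, eq_comm, zero_pow two_ne_zero, radiusSq_eq_zero_iff] at hr
    rw [hmk]
    rcases hr with hr | hr
    · exact Or.inl ⟨z.1.1.2, hd, by simp only [← hr]⟩
    · exact Or.inr ⟨z.1.1.2, hd, by simp only [← hr]⟩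
  · have key : ∀ p s, s ∈ criticalSet c → radiusSq c a (p, s) = 0 →
        stripMk hc.continuous ha hu (p, s) ∈ reebVertices m c fun x => c x + a := by
      intro p s hs hr
      have hmem : (((p, s), 0) : Ambient m) ∈ hypersurface m c fun x => c x + a := by
        rw [mem_hypersurface_iff hc.continuous ha, hr]
        simp
      exact ⟨⟨_, hmem⟩, (isCriticalPointOn_iff hc ha hmem).2 ⟨rfl, hs⟩, hmk _⟩
    rintro (⟨s, hs, rfl⟩ | ⟨s, hs, rfl⟩)
    · exact key _ _ hs (radiusSq_eq_zero_iff.2 (Or.inl rfl))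
    · exact key _ _ hs (radiusSq_eq_zero_iff.2 (Or.inr rfl))

end CriticalPoints

end ReebTS

theorem theorem2 (m : ℕ) (hm : 2 ≤ m) (c₁ c₂ : ℝ → ℝ) (N a : ℝ)
    (hc₁ : ReebTS.IsTS c₁) (hS : (ReebTS.criticalSet c₁).Nonempty)
    (hN : 0 < N) (hcons : ReebTS.ConsecutiveValuesDifferBy c₁ N)
    (ha : 0 < a) (haN : a < N) (hc₂ : ∀ x, c₂ x = c₁ x + a)
    (hline : m = 2 → ∀ p : ℝ, ∃ t : ℝ, (p, t) ∉ ReebTS.region c₁ c₂) :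
    ReebTS.IsGraphWithEnds (ReebTS.ReebSpace (ReebTS.height m c₁ c₂))
        (ReebTS.reebVertices m c₁ c₂) ∧
      (∀ v ∈ ReebTS.reebVertices m c₁ c₂,
        ReebTS.degree (ReebTS.reebVertices m c₁ c₂) v = 1 ∨
        ReebTS.degree (ReebTS.reebVertices m c₁ c₂) v = 2 ∨
        ReebTS.degree (ReebTS.reebVertices m c₁ c₂) v = 3) ∧
      ReebTS.IsDigraphBy (ReebTS.reebVertices m c₁ c₂)
        (ReebTS.reebInduced (ReebTS.height m c₁ c₂)) ∧
      (∀ v ∈ ReebTS.reebVertices m c₁ c₂,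
        IsLocalExtr (ReebTS.reebInduced (ReebTS.height m c₁ c₂)) v →
        ReebTS.degree (ReebTS.reebVertices m c₁ c₂) v = 1) := by
  obtain rfl : c₂ = fun x => c₁ x + a := funext hc₂
  obtain ⟨u, hu⟩ := ReebTS.exists_norm_eq_one hm
  have hR := ReebTS.isStripReeb_stripMk hc₁.1.continuous ha hm hline hu
  have hT := hc₁.isTame hS hcons ha haN
  rw [ReebTS.reebVertices_eq hc₁.1 ha hm hline hu]
  exact ⟨hR.isGraphWithEnds hT, fun v hv => hR.degree_eq_one_or hT hv, hR.isDigraphBy hT,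
    fun v hv hext => hR.degree_eq_one_of_isLocalExtr hT hv hext⟩
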